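/- **Conventions.** For a finitely generated group $G$ with finite generating set $S$, let $L_{G}$ be the word length with respect to $S$. For finitely supported $f,g:G\to\mathbb R^+=[0,\infty)$ put $(f*g)(\gamma)=\sum_{\mu\in G}f(\mu)g(\mu^{-1}\gamma)$ and $\|f\|_2=\big(\sum_{\gamma}f(\gamma)^2\big)^{1/2}$. The group $G$ has *Rapid Decay* if for some (equivalently, any) finite generating set there is a polynomial $P$ such that for every $r>0$ and all finitely supported $f,g:G\to\mathbb R^+$ with $f$ supported in $\{\gamma: L_G(\gamma)\le r\}$ one has $\|f*g\|_2\le P(r)\,\|f\|_2\,\|g\|_2$. Let $\mathcal G$ be a graph of groups over a graph $\Gamma$ with finitely many vertices and edges (loops and multiple edges allowed): to each vertex $v$ is attached a group $G_v$, to each oriented edge $e$ (from $i(e)$ to $t(e)$, with opposite edge $\bar e$) a group $G_e=G_{\bar e}$ and a monomorphism $\imath_e:G_e\to G_{t(e)}$. A *$\mathcal G$-sequence* from $v$ to $w$ is $s=(g_0,e_1,g_1,\dots,e_k,g_k)$ where $k\ge 0$, $e_1\cdots e_k$ is an edge path from $v$ to $w$, $g_0\in G_v$ and $g_j\in G_{t(e_j)}$;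 it is a *$\mathcal G$-loop at $v$* if $v=w$. Concatenation multiplies the two vertex elements at the junction. Let $\sim$ be the equivalence relation on $\mathcal G$-sequences, compatible with concatenation, generated by $$(g,e,g')\sim(g\,\imath_{\bar e}(h),e,\imath_e(h^{-1})g'),\qquad (g,e,1,\bar e,k)\sim(gk),$$ with $h\in G_e$, $g,k\in G_{i(e)}$, $g'\in G_{t(e)}$, and write $[s]$ for the class of $s$. For a vertex $v_0$, the fundamental group $\pi_1(\mathcal G)=\pi_1(\mathcal G,v_0)$ is the group of classes of $\mathcal G$-loops at $v_0$ under concatenation. Given finite generating sets of the vertex groups, put $L_\Gamma(s)=k+\sum_{j=0}^kL_{G_{v_j}}(g_j)$, where $v_j$ is the vertex with $g_j\in G_{v_j}$. The graph of groups $\mathcal G$ has *loose polynomial distortion* if for some (equivalently, any) choice of finite generating sets of the vertex groups there is a polynomial $P$ such that for every vertex $v$, every $g\in G_v$ and every $\mathcal G$-loop $s$ at $v$ with $[s]=[(g)]$, $$L_{G_v}(g)\le P(L_\Gamma(s)).$$ **Proposition.** Let $\mathcal G$ be a graph of groups over a finite graph, with finitely generated vertex groups and with loose polynomial distortion. If every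 vertex group has Rapid Decay, then for every base vertex $v_0$ the group $\pi_1(\mathcal G,v_0)$ is finitely generated and has Rapid Decay. -/

import Mathlib

open scoped NNReal

set_option linter.checkUnivs false

universe u₁ u₂ u₃ u₄ u

section RapidDecay

variable {G : Type u} [Group G]

/-- The word length of `g` with respect to `S`: the least number of letters of a word
in `S ∪ S⁻¹` that represents `g` (only used for generating sets `S`). -/
noncomputable def wordLength (S : Set G) (g : G) : ℕ :=
  sInf {n | ∃ l : List G, l.length = n ∧ (∀ x ∈ l, x ∈ S ∨ x⁻¹ ∈ S) ∧ l.prod = g}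

/-- The `ℓ²`-norm of a finitely supported function `f : G → ℝ⁺`. -/
noncomputable def ell2Norm (f : MonoidAlgebra ℝ≥0 G) : ℝ :=
  Real.sqrt (∑ x ∈ f.coeff.support, (f.coeff x : ℝ) ^ 2)

/-- Rapid Decay with respect to a length function `L`. The product of `MonoidAlgebra ℝ≥0 G`
is the convolution of finitely supported functions `G → ℝ⁺`. -/
def HasRapidDecayWrt (L : G → ℝ) : Prop :=
  ∃ P : Polynomial ℝ, ∀ r : ℝ, 0 < r → ∀ f g : MonoidAlgebra ℝ≥0 G,
    (∀ x ∈ f.coeff.support, L x ≤ r) →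
      ell2Norm (f * g) ≤ P.eval r * ell2Norm f * ell2Norm g

variable (G) in
/-- The Rapid Decay property of a finitely generated group: Rapid Decay with respect to the
word length of some finite generating set (word lengths of two finite generating sets are
bi-Lipschitz equivalent, so the choice of the set does not matter). -/
def HasRapidDecay : Prop :=
  ∃ S : Set G, S.Finite ∧ Subgroup.closure S = ⊤ ∧
    HasRapidDecayWrt (fun g => (wordLength S g : ℝ))

end RapidDecay

/-- A graph of groups over the graph with vertex set `V` and set of unoriented edges `E`; loops
and multiple edges are allowed. For each `e : E` one of the two orientations is recorded, running
from `src e` to `tgt e`. -/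
structure GraphOfGroups (V : Type u₁) (E : Type u₂) where
  /-- initial vertex of the recorded orientation -/
  src : E → V
  /-- terminal vertex of the recorded orientation -/
  tgt : E → V
  /-- the vertex groups -/
  vertexGroup : V → Type u₃
  /-- the edge groups -/
  edgeGroup : E → Type u₄
  [vertexGroupInst : ∀ v, Group (vertexGroup v)]
  [edgeGroupInst : ∀ e, Group (edgeGroup e)]
  /-- the embedding of an edge group into the vertex group of the initial vertex -/
  toSrc : ∀ e, edgeGroup e →* vertexGroup (src e)
  /-- the embedding of an edge group into the vertex group of the terminal vertex -/
  toTgt : ∀ e, edgeGroup e →* vertexGroup (tgt e)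
  toSrc_injective : ∀ e, Function.Injective (toSrc e)
  toTgt_injective : ∀ e, Function.Injective (toTgt e)

attribute [instance] GraphOfGroups.vertexGroupInst GraphOfGroups.edgeGroupInst

namespace GraphOfGroups

variable {V : Type u₁} {E : Type u₂}

/-- `𝒢.OEdge v w`: the oriented edges from `v` to `w`. Every `e : E` gives two of them. -/
inductive OEdge (𝒢 : GraphOfGroups.{u₁, u₂, u₃, u₄} V E) : V → V → Type (max u₁ u₂)
  | fwd (e : E) : OEdge 𝒢 (𝒢.src e) (𝒢.tgt e)
  | bwd (e : E) : OEdge 𝒢 (𝒢.tgt e) (𝒢.src e)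

namespace OEdge

variable {𝒢 : GraphOfGroups.{u₁, u₂, u₃, u₄} V E} {v w : V}

/-- the same edge with the opposite orientation -/
def rev : ∀ {v w : V}, 𝒢.OEdge v w → 𝒢.OEdge w v
  | _, _, fwd e => bwd e
  | _, _, bwd e => fwd e

/-- the underlying unoriented edge -/
def under : ∀ {v w : V}, 𝒢.OEdge v w → E
  | _, _, fwd e => e
  | _, _, bwd e => e

/-- the embedding of the edge group into the group of the terminal vertex -/
def inclTerm : ∀ {v w : V} (e : 𝒢.OEdge v w), 𝒢.edgeGroup e.under →* 𝒢.vertexGroup w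
  | _, _, fwd e => 𝒢.toTgt e
  | _, _, bwd e => 𝒢.toSrc e

/-- the embedding of the edge group into the group of the initial vertex -/
def inclInit : ∀ {v w : V} (e : 𝒢.OEdge v w), 𝒢.edgeGroup e.under →* 𝒢.vertexGroup v
  | _, _, fwd e => 𝒢.toSrc e
  | _, _, bwd e => 𝒢.toTgt e

theorem rev_rev (e : 𝒢.OEdge v w) : e.rev.rev = e := by
  cases e <;> rfl

end OEdge

/-- `𝒢.GSeq v w`: the sequences `(g₀, e₁, g₁, …, e_k, g_k)`, where `e₁ ⋯ e_k` is an edge path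
from `v` to `w`, `g₀` lies in the group of `v` and `g_j` in the group of the end of `e_j`. -/
inductive GSeq (𝒢 : GraphOfGroups.{u₁, u₂, u₃, u₄} V E) : V → V → Type (max u₁ u₂ u₃)
  | vert {v : V} (g : 𝒢.vertexGroup v) : GSeq 𝒢 v v
  | cons {v w x : V} (g : 𝒢.vertexGroup v) (e : 𝒢.OEdge v w) (s : GSeq 𝒢 w x) : GSeq 𝒢 v x

namespace GSeq

variable {𝒢 : GraphOfGroups.{u₁, u₂, u₃, u₄} V E} {u v w x : V}

/-- multiplication of the first vertex element by `g` on the left -/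
def lmul : ∀ {v w : V}, 𝒢.vertexGroup v → 𝒢.GSeq v w → 𝒢.GSeq v w
  | _, _, g, vert h => vert (g * h)
  | _, _, g, cons h e s => cons (g * h) e s

/-- Concatenation:
`(g₀, …, e_k, g_k) (h₀, f₁, …, h_l) = (g₀, …, e_k, g_k * h₀, f₁, …, h_l)`. -/
def concat : ∀ {u v w : V}, 𝒢.GSeq u v → 𝒢.GSeq v w → 𝒢.GSeq u w
  | _, _, _, vert g, t => lmul g t
  | _, _, _, cons g e s, t => cons g e (concat s t)

/-- the sequence read backwards, with all its terms inverted -/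
def inv : ∀ {v w : V}, 𝒢.GSeq v w → 𝒢.GSeq w v
  | _, _, vert g => vert g⁻¹
  | _, _, cons g e s => concat (inv s) (cons 1 e.rev (vert g⁻¹))

/-- The `Γ`-length of a sequence, for generating sets `S v` of the vertex groups: the number of
edges plus the sum of the word lengths of the vertex elements. -/
noncomputable def length (S : ∀ v, Set (𝒢.vertexGroup v)) : ∀ {v w : V}, 𝒢.GSeq v w → ℕ
  | v, _, vert g => wordLength (S v) g
  | v, _, cons g _ s => wordLength (S v) g + 1 + length S s

/-- The equivalence of sequences: the equivalence relation, compatible with concatenation, that is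
generated by `(g, e, g') ∼ (g ι_ē(h), e, ι_e(h⁻¹) g')` and `(g, e, 1, ē, k) ∼ (g k)`. -/
inductive Rel : ∀ {v w : V}, 𝒢.GSeq v w → 𝒢.GSeq v w → Prop
  | slide {v w : V} (g : 𝒢.vertexGroup v) (e : 𝒢.OEdge v w) (g' : 𝒢.vertexGroup w)
      (h : 𝒢.edgeGroup e.under) :
      Rel (cons g e (vert g')) (cons (g * e.inclInit h) e (vert (e.inclTerm h⁻¹ * g')))
  | cancel {v w : V} (g : 𝒢.vertexGroup v) (e : 𝒢.OEdge v w) (k : 𝒢.vertexGroup v) :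
      Rel (cons g e (cons 1 e.rev (vert k))) (vert (g * k))
  | concat {u v w : V} {s s' : 𝒢.GSeq u v} {t t' : 𝒢.GSeq v w} :
      Rel s s' → Rel t t' → Rel (s.concat t) (s'.concat t')
  | refl {v w : V} (s : 𝒢.GSeq v w) : Rel s s
  | symm {v w : V} {s t : 𝒢.GSeq v w} : Rel s t → Rel t s
  | trans {v w : V} {s t r : 𝒢.GSeq v w} : Rel s t → Rel t r → Rel s r

theorem lmul_lmul (g h : 𝒢.vertexGroup v) (s : 𝒢.GSeq v w) :
    lmul g (lmul h s) = lmul (g * h) s := by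
  cases s <;> simp [lmul, mul_assoc]

theorem one_lmul (s : 𝒢.GSeq v w) : lmul 1 s = s := by
  cases s <;> simp [lmul]

theorem concat_lmul (g : 𝒢.vertexGroup u) (s : 𝒢.GSeq u v) (t : 𝒢.GSeq v w) :
    (lmul g s).concat t = lmul g (s.concat t) := by
  cases s with
  | vert h => exact (lmul_lmul g h t).symm
  | cons h e s => rfl

theorem concat_assoc (s : 𝒢.GSeq u v) (t : 𝒢.GSeq v w) (r : 𝒢.GSeq w x) :
    (s.concat t).concat r = s.concat (t.concat r) := by
  induction s with
  | vert g => simp [concat, concat_lmul]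
  | cons g e s ih => simp [concat, ih]

theorem concat_one (s : 𝒢.GSeq v w) : s.concat (vert 1) = s := by
  induction s with
  | vert g => simp [concat, lmul]
  | cons g e s ih => simp [concat, ih]

theorem inv_lmul (g : 𝒢.vertexGroup v) (s : 𝒢.GSeq v w) :
    (lmul g s).inv = s.inv.concat (vert g⁻¹) := by
  cases s <;> simp [lmul, inv, concat, concat_assoc]

theorem inv_concat (s : 𝒢.GSeq u v) (t : 𝒢.GSeq v w) :
    (s.concat t).inv = t.inv.concat s.inv := by
  induction s with
  | vert g => simp [concat, inv, inv_lmul]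
  | cons g e s ih => simp [concat, inv, ih, concat_assoc]

theorem Rel.inv {s t : 𝒢.GSeq v w} (h : Rel s t) : Rel s.inv t.inv := by
  induction h with
  | slide g e g' h =>
    have key : Rel (cons g'⁻¹ e.rev (vert g⁻¹))
        (cons (g'⁻¹ * e.inclTerm h) e.rev (vert ((e.inclInit h)⁻¹ * g⁻¹))) := by
      have := Rel.slide g'⁻¹ e.rev g⁻¹
      cases e <;> exact map_inv (OEdge.inclInit _) h ▸ this h
    simpa [GSeq.inv, GSeq.concat, lmul] using key
  | cancel g e k =>
    have := Rel.cancel k⁻¹ e g⁻¹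
    simpa [GSeq.inv, GSeq.concat, lmul, OEdge.rev_rev] using this
  | concat _ _ ih₁ ih₂ =>
    rw [inv_concat, inv_concat]
    exact Rel.concat ih₂ ih₁
  | refl s => exact Rel.refl _
  | symm _ ih => exact Rel.symm ih
  | trans _ _ ih₁ ih₂ => exact Rel.trans ih₁ ih₂

theorem inv_concat_self (s : 𝒢.GSeq v w) : Rel (s.inv.concat s) (vert 1) := by
  induction s with
  | vert g => simpa [GSeq.inv, GSeq.concat, lmul] using Rel.refl _
  | @cons a b c g e s ih =>
    have h1 : Rel ((cons 1 e.rev (vert g⁻¹)).concat (cons g e (vert 1))) (vert 1) := by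
      have := Rel.cancel (1 : 𝒢.vertexGroup b) e.rev 1
      rw [OEdge.rev_rev] at this
      simpa [GSeq.concat, lmul] using this
    have h2 : cons g e s = (cons g e (vert 1)).concat s := by
      simp [GSeq.concat, one_lmul]
    have h3 : (cons g e s).inv.concat (cons g e s) =
        s.inv.concat (((cons 1 e.rev (vert g⁻¹)).concat (cons g e (vert 1))).concat s) := by
      rw [concat_assoc, ← h2]
      simp only [GSeq.inv, concat_assoc]
    rw [h3]
    refine Rel.trans (Rel.concat (Rel.refl _) (Rel.concat h1 (Rel.refl _))) ?_
    simpa [GSeq.concat, one_lmul] using ih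

/-- equivalence of loops at `v`, as a setoid -/
def loopSetoid (𝒢 : GraphOfGroups.{u₁, u₂, u₃, u₄} V E) (v : V) : Setoid (𝒢.GSeq v v) where
  r := Rel
  iseqv := ⟨Rel.refl, Rel.symm, Rel.trans⟩

end GSeq

/-- The fundamental group `π₁(𝒢, v₀)`: the equivalence classes of `𝒢`-loops based at `v₀`. -/
def FundamentalGroup (𝒢 : GraphOfGroups.{u₁, u₂, u₃, u₄} V E) (v₀ : V) : Type (max u₁ u₂ u₃) :=
  Quotient (GSeq.loopSetoid 𝒢 v₀)

/-- The group law is induced by concatenation. -/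
instance (𝒢 : GraphOfGroups.{u₁, u₂, u₃, u₄} V E) (v₀ : V) : Group (𝒢.FundamentalGroup v₀) where
  mul := Quotient.map₂ GSeq.concat fun _ _ h _ _ h' => GSeq.Rel.concat h h'
  one := Quotient.mk _ (GSeq.vert 1)
  inv := Quotient.map GSeq.inv fun _ _ h => GSeq.Rel.inv h
  mul_assoc := by
    rintro ⟨a⟩ ⟨b⟩ ⟨c⟩
    exact congrArg (Quotient.mk _) (GSeq.concat_assoc a b c)
  one_mul := by
    rintro ⟨a⟩
    exact congrArg (Quotient.mk _) (GSeq.one_lmul a)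
  mul_one := by
    rintro ⟨a⟩
    exact congrArg (Quotient.mk _) (GSeq.concat_one a)
  inv_mul_cancel := by
    rintro ⟨a⟩
    exact Quotient.sound (GSeq.inv_concat_self a)

/-- Loose polynomial distortion: for some finite generating sets of the vertex groups there is a
polynomial `P` such that `L_{G_v}(g) ≤ P(L_Γ(s))` for every vertex `v`, every `g ∈ G_v` and every
`𝒢`-loop `s` at `v` that is equivalent to the sequence `(g)`. -/
def HasLoosePolynomialDistortion (𝒢 : GraphOfGroups.{u₁, u₂, u₃, u₄} V E) : Prop :=
  ∃ S : ∀ v, Set (𝒢.vertexGroup v), (∀ v, (S v).Finite ∧ Subgroup.closure (S v) = ⊤) ∧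
    ∃ P : Polynomial ℝ, ∀ (v : V) (g : 𝒢.vertexGroup v) (s : 𝒢.GSeq v v),
      GSeq.Rel s (GSeq.vert g) → (wordLength (S v) g : ℝ) ≤ P.eval (s.length S : ℝ)

end GraphOfGroups

/-!
The fundamental group acts on the Bass–Serre tree, and the Rapid Decay inequality is proved by
cutting loops at medians of triangles in that tree.

**The tree.** Every sequence is equivalent to a unique normal form: right cosets of the edge groups
carry chosen representatives, and a sequence is reduced by letting it act from the left on normal forms
(`GSeq.Rel.seqMul_eq`, an argument in the manner of van der Waerden). Hence the vertex groups embed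
in the fundamental groupoid `Path`, and the number `depth` of edges of the normal form satisfies
`depth_comp_of_depth_eq_one` and `depth_inv_comp_eq_zero`: neighbours in the tree have distances
differing by one from any vertex, and there is one neighbour only in the direction of that vertex.
These two facts yield the uniqueness of points on geodesics
(`depth_inv_comp_eq_zero_of_geodesic`), the existence of medians (`exists_median`), and the fact
that an edge path passes through all vertices of the geodesic between its ends
(`exists_length_le`).

**Coordinates.** For each tree vertex `c` over `v` fix a morphism `rep c` of least length that
leads to it. A loop `p` whose geodesic passes through `c` is uniquely
`rep c ⬝ g ⬝ (rep d)⁻¹` with `g` in the group of `v`. If `p` has length at most `r`, then so have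
`rep c` and `rep d`, because a shortest sequence for `p` passes through `c`; so `g` is represented
by a loop of length at most `3 r`, and loose polynomial distortion bounds its word length
polynomially in `r`.

**The estimate.** In its trilinear form, Rapid Decay bounds `∑ f(p) g(q) k(p q)` by
`P(r) ‖f‖ ‖g‖ ‖k‖`. The median of the triangle `1, p, p q` gives coordinates
`p = (c, x, d)`, `q = (d, y, e)`, `p q = (c, x y, e)`. For a fixed type of the median and fixed
distances of it from two corners, at most `r` both, the sum is that of a product of matrices with
entries in the group algebra of one vertex group, and the inequality for the vertex group with
two applications of the Cauchy–Schwarz inequality (`tsum_matrix_le`) bounds it. Adding up the at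
most `(r + 1) ^ 2 |V|` parts gives a polynomial bound with respect to the length of loops
(`hasRapidDecayWrt_len`), which a multiple of any word length dominates.
-/

open scoped ENNReal

/-! ### Normal forms of sequences -/

namespace GraphOfGroups

variable {V : Type u₁} {E : Type u₂} {𝒢 : GraphOfGroups.{u₁, u₂, u₃, u₄} V E} {u v w : V}

namespace OEdge

theorem inclTerm_injective (e : 𝒢.OEdge v w) : Function.Injective e.inclTerm := by
  cases e
  · exact 𝒢.toTgt_injective _
  · exact 𝒢.toSrc_injective _

/-- The image of the edge group in the group of the terminal vertex. -/
def edgeSubgroup (e : 𝒢.OEdge v w) : Subgroup (𝒢.vertexGroup w) := e.inclTerm.range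

open Classical in
/-- The identification `ι_e(h) ↦ ι_ē(h)` of the two images of the edge group, extended by `1`
outside `e.edgeSubgroup`. -/
noncomputable def transfer (e : 𝒢.OEdge v w) (g : 𝒢.vertexGroup w) : 𝒢.vertexGroup v :=
  if h : ∃ a, e.inclTerm a = g then e.inclInit h.choose else 1

theorem transfer_inclTerm (e : 𝒢.OEdge v w) (a : 𝒢.edgeGroup e.under) :
    e.transfer (e.inclTerm a) = e.inclInit a := by
  have h : ∃ b, e.inclTerm b = e.inclTerm a := ⟨a, rfl⟩
  rw [transfer, dif_pos h, e.inclTerm_injective h.choose_spec]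

theorem transfer_one (e : 𝒢.OEdge v w) : e.transfer 1 = 1 := by
  simpa using e.transfer_inclTerm 1

theorem transfer_mul (e : 𝒢.OEdge v w) {g h : 𝒢.vertexGroup w} (hg : g ∈ e.edgeSubgroup)
    (hh : h ∈ e.edgeSubgroup) : e.transfer (g * h) = e.transfer g * e.transfer h := by
  obtain ⟨a, rfl⟩ := hg
  obtain ⟨b, rfl⟩ := hh
  rw [← map_mul, transfer_inclTerm, transfer_inclTerm, transfer_inclTerm, map_mul]

theorem inclInit_mem (e : 𝒢.OEdge v w) (a : 𝒢.edgeGroup e.under) :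
    e.inclInit a ∈ e.rev.edgeSubgroup := by
  cases e <;> exact ⟨a, rfl⟩

theorem transfer_rev_inclInit (e : 𝒢.OEdge v w) (a : 𝒢.edgeGroup e.under) :
    e.rev.transfer (e.inclInit a) = e.inclTerm a := by
  cases e with
  | fwd e => exact transfer_inclTerm (bwd e) a
  | bwd e => exact transfer_inclTerm (fwd e) a

theorem transfer_mem (e : 𝒢.OEdge v w) {g : 𝒢.vertexGroup w} (hg : g ∈ e.edgeSubgroup) :
    e.transfer g ∈ e.rev.edgeSubgroup := by
  obtain ⟨a, rfl⟩ := hg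
  rw [transfer_inclTerm]
  exact e.inclInit_mem a

theorem transfer_rev_transfer (e : 𝒢.OEdge v w) {g : 𝒢.vertexGroup w}
    (hg : g ∈ e.edgeSubgroup) : e.rev.transfer (e.transfer g) = g := by
  obtain ⟨a, rfl⟩ := hg
  rw [transfer_inclTerm, transfer_rev_inclInit]

open Classical in
/-- The chosen representative of the right coset of `g` modulo the image of the edge group; the
subgroup itself is represented by `1`. -/
noncomputable def cosetRep (e : 𝒢.OEdge v w) (g : 𝒢.vertexGroup w) : 𝒢.vertexGroup w :=
  if g ∈ e.edgeSubgroup then 1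
  else Quotient.out (Quotient.mk (QuotientGroup.rightRel e.edgeSubgroup) g)

theorem mul_inv_cosetRep_mem (e : 𝒢.OEdge v w) (g : 𝒢.vertexGroup w) :
    g * (e.cosetRep g)⁻¹ ∈ e.edgeSubgroup := by
  rw [cosetRep]
  split_ifs with h
  · simpa using h
  · exact QuotientGroup.rightRel_apply.1
      (Quotient.mk_out (s := QuotientGroup.rightRel e.edgeSubgroup) g)

theorem cosetRep_of_mem (e : 𝒢.OEdge v w) {g : 𝒢.vertexGroup w} (hg : g ∈ e.edgeSubgroup) :
    e.cosetRep g = 1 := if_pos hg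

theorem cosetRep_mul (e : 𝒢.OEdge v w) {a : 𝒢.vertexGroup w} (ha : a ∈ e.edgeSubgroup)
    (g : 𝒢.vertexGroup w) : e.cosetRep (a * g) = e.cosetRep g := by
  have h1 : a * g ∈ e.edgeSubgroup ↔ g ∈ e.edgeSubgroup := Subgroup.mul_mem_cancel_left _ ha
  have h2 : Quotient.mk (QuotientGroup.rightRel e.edgeSubgroup) (a * g) =
      Quotient.mk (QuotientGroup.rightRel e.edgeSubgroup) g := by
    refine Quotient.sound (QuotientGroup.rightRel_apply.2 ?_)
    simpa using ha
  rw [cosetRep, cosetRep, h2]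
  split_ifs <;> tauto

theorem cosetRep_cosetRep (e : 𝒢.OEdge v w) (g : 𝒢.vertexGroup w) :
    e.cosetRep (e.cosetRep g) = e.cosetRep g := by
  conv_rhs => rw [← inv_mul_cancel_right g (e.cosetRep g)]
  rw [e.cosetRep_mul (e.mul_inv_cosetRep_mem g)]

theorem mem_of_cosetRep_eq_one (e : 𝒢.OEdge v w) {g : 𝒢.vertexGroup w}
    (h : e.cosetRep g = 1) : g ∈ e.edgeSubgroup := by
  simpa [h] using e.mul_inv_cosetRep_mem g

end OEdge

namespace GSeq

theorem lmul_vert (g h : 𝒢.vertexGroup v) : lmul g (vert h) = vert (g * h) := rfl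

theorem lmul_cons (g h : 𝒢.vertexGroup v) (e : 𝒢.OEdge v w) (s : 𝒢.GSeq w u) :
    lmul g (cons h e s) = cons (g * h) e s := rfl

/-- The number of edges of a sequence. -/
def edgeCount : ∀ {v w : V}, 𝒢.GSeq v w → ℕ
  | _, _, vert _ => 0
  | _, _, cons _ _ s => edgeCount s + 1

theorem edgeCount_lmul (g : 𝒢.vertexGroup v) (s : 𝒢.GSeq v w) :
    (lmul g s).edgeCount = s.edgeCount := by
  cases s <;> rfl

theorem edgeCount_concat (s : 𝒢.GSeq u v) (t : 𝒢.GSeq v w) :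
    (s.concat t).edgeCount = s.edgeCount + t.edgeCount := by
  induction s with
  | vert g => simp [concat, edgeCount_lmul, edgeCount]
  | cons g e s ih => simp only [concat, edgeCount, ih]; omega

theorem edgeCount_inv (s : 𝒢.GSeq v w) : s.inv.edgeCount = s.edgeCount := by
  induction s with
  | vert g => rfl
  | cons g e s ih => simp [inv, edgeCount_concat, edgeCount, ih]

open Classical in
/-- Left multiplication of a normal form by an edge `e`: the first vertex element is written as
`a * t` with `a` in the image of the edge group and `t` a coset representative, and `a` is moved
across `e`; if `t = 1` and the sequence continues with `ē`, then `e` and `ē` are cancelled. -/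
noncomputable def edgeMul : ∀ {v w u : V}, 𝒢.OEdge v w → 𝒢.GSeq w u → 𝒢.GSeq v u
  | _, _, _, e, vert g => cons (e.transfer (g * (e.cosetRep g)⁻¹)) e (vert (e.cosetRep g))
  | v, w, _, e, @cons _ _ _ _ x _ g e' s =>
    if h : g ∈ e.edgeSubgroup ∧ (⟨x, e'⟩ : Σ x, 𝒢.OEdge w x) = ⟨v, e.rev⟩ then
      lmul (e.transfer g) (cast (congrArg (fun y : Σ x, 𝒢.OEdge w x => 𝒢.GSeq y.1 _) h.2) s)
    else cons (e.transfer (g * (e.cosetRep g)⁻¹)) e (cons (e.cosetRep g) e' s)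

theorem edgeMul_cons_rev (e : 𝒢.OEdge v w) {g : 𝒢.vertexGroup w} (hg : g ∈ e.edgeSubgroup)
    (s : 𝒢.GSeq v u) : edgeMul e (cons g e.rev s) = lmul (e.transfer g) s := by
  simp [edgeMul, hg]

theorem edgeMul_rev_cons (e : 𝒢.OEdge v w) {g : 𝒢.vertexGroup v}
    (hg : g ∈ e.rev.edgeSubgroup) (s : 𝒢.GSeq w u) :
    edgeMul e.rev (cons g e s) = lmul (e.rev.transfer g) s := by
  have := edgeMul_cons_rev e.rev hg s
  rwa [OEdge.rev_rev] at this

theorem edgeMul_cons_of_not {x : V} (e : 𝒢.OEdge v w) {g : 𝒢.vertexGroup w}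
    (e' : 𝒢.OEdge w x) (s : 𝒢.GSeq x u)
    (h : ¬(g ∈ e.edgeSubgroup ∧ (⟨x, e'⟩ : Σ x, 𝒢.OEdge w x) = ⟨v, e.rev⟩)) :
    edgeMul e (cons g e' s) =
      cons (e.transfer (g * (e.cosetRep g)⁻¹)) e (cons (e.cosetRep g) e' s) := by
  rw [edgeMul, dif_neg h]

/-- The two shapes of `edgeMul e s`: cancellation, or prolongation by `e`. -/
theorem edgeMul_cases (e : 𝒢.OEdge v w) (s : 𝒢.GSeq w u) :
    (∃ g ∈ e.edgeSubgroup, ∃ s', s = cons g e.rev s' ∧ edgeMul e s = lmul (e.transfer g) s') ∨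
    ∃ a ∈ e.edgeSubgroup, ∃ s', s = lmul a s' ∧ edgeMul e s = cons (e.transfer a) e s' := by
  cases s with
  | vert g =>
    exact Or.inr ⟨_, e.mul_inv_cosetRep_mem g, vert (e.cosetRep g), by simp [lmul], rfl⟩
  | @cons _ x _ g e' s =>
    by_cases h : g ∈ e.edgeSubgroup ∧ (⟨x, e'⟩ : Σ x, 𝒢.OEdge w x) = ⟨v, e.rev⟩
    · obtain ⟨hg, he⟩ := h
      obtain ⟨rfl, he⟩ := Sigma.mk.inj he
      obtain rfl := eq_of_heq he
      exact Or.inl ⟨g, hg, s, rfl, edgeMul_cons_rev e hg s⟩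
    · exact Or.inr ⟨_, e.mul_inv_cosetRep_mem g, cons (e.cosetRep g) e' s, by simp [lmul],
        edgeMul_cons_of_not e e' s h⟩

theorem edgeMul_lmul (e : 𝒢.OEdge v w) {a : 𝒢.vertexGroup w} (ha : a ∈ e.edgeSubgroup)
    (s : 𝒢.GSeq w u) : edgeMul e (lmul a s) = lmul (e.transfer a) (edgeMul e s) := by
  have key (g : 𝒢.vertexGroup w) : e.transfer (a * g * (e.cosetRep g)⁻¹) =
      e.transfer a * e.transfer (g * (e.cosetRep g)⁻¹) := by
    rw [mul_assoc, e.transfer_mul ha (e.mul_inv_cosetRep_mem g)]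
  cases s with
  | vert g => simp [lmul, edgeMul, e.cosetRep_mul ha, key]
  | @cons _ x _ g e' s =>
    have hmem : a * g ∈ e.edgeSubgroup ↔ g ∈ e.edgeSubgroup := Subgroup.mul_mem_cancel_left _ ha
    by_cases h : g ∈ e.edgeSubgroup ∧ (⟨x, e'⟩ : Σ x, 𝒢.OEdge w x) = ⟨v, e.rev⟩
    · obtain ⟨hg, he⟩ := h
      obtain ⟨rfl, he⟩ := Sigma.mk.inj he
      obtain rfl := eq_of_heq he
      rw [lmul_cons, edgeMul_cons_rev e hg, edgeMul_cons_rev e (hmem.2 hg), e.transfer_mul ha hg,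
        lmul_lmul]
    · rw [lmul_cons, edgeMul_cons_of_not e e' s h, edgeMul_cons_of_not e e' s (by rwa [hmem])]
      simp only [lmul_cons, e.cosetRep_mul ha, key]

/-- `s` may follow the edge `e` in a normal form: vertex elements after an edge are coset
representatives, and `e, 1, ē` does not occur. -/
def NormalAfter : ∀ {v w u : V}, 𝒢.OEdge v w → 𝒢.GSeq w u → Prop
  | _, _, _, e, vert g => e.cosetRep g = g
  | v, w, _, e, @cons _ _ _ _ x _ g e' s =>
    e.cosetRep g = g ∧ ¬(g = 1 ∧ (⟨x, e'⟩ : Σ x, 𝒢.OEdge w x) = ⟨v, e.rev⟩) ∧ NormalAfter e' s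

/-- `s` is in normal form; there is no condition on the first vertex element. -/
def IsNormal : ∀ {v w : V}, 𝒢.GSeq v w → Prop
  | _, _, vert _ => True
  | _, _, cons _ e s => NormalAfter e s

theorem isNormal_vert (g : 𝒢.vertexGroup v) : IsNormal (vert g) := by trivial

theorem NormalAfter.isNormal {e : 𝒢.OEdge v w} {s : 𝒢.GSeq w u} (h : NormalAfter e s) :
    IsNormal s := by
  cases s with
  | vert g => trivial
  | cons g e' s => exact h.2.2

theorem IsNormal.lmul {s : 𝒢.GSeq v w} (h : IsNormal s) (g : 𝒢.vertexGroup v) :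
    IsNormal (lmul g s) := by
  cases s with
  | vert g => trivial
  | cons g e' s => exact h

theorem IsNormal.edgeMul {s : 𝒢.GSeq w u} (hs : IsNormal s) (e : 𝒢.OEdge v w) :
    IsNormal (edgeMul e s) := by
  cases s with
  | vert g => exact e.cosetRep_cosetRep g
  | @cons _ x _ g e' s =>
    by_cases h : g ∈ e.edgeSubgroup ∧ (⟨x, e'⟩ : Σ x, 𝒢.OEdge w x) = ⟨v, e.rev⟩
    · obtain ⟨hg, he⟩ := h
      obtain ⟨rfl, he⟩ := Sigma.mk.inj he
      obtain rfl := eq_of_heq he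
      rw [edgeMul_cons_rev e hg]
      exact IsNormal.lmul (NormalAfter.isNormal hs) _
    · rw [edgeMul_cons_of_not e e' s h]
      exact ⟨e.cosetRep_cosetRep g, fun h' => h ⟨e.mem_of_cosetRep_eq_one h'.1, h'.2⟩, hs⟩

theorem NormalAfter.edgeMul_eq {e : 𝒢.OEdge v w} {s : 𝒢.GSeq w u} (h : NormalAfter e s) :
    edgeMul e s = cons 1 e s := by
  cases s with
  | vert g =>
    have h : e.cosetRep g = g := h
    simp [edgeMul, h, e.transfer_one]
  | @cons _ x _ g e' s =>
    obtain ⟨h1, h2, -⟩ := h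
    rw [edgeMul_cons_of_not e e' s
      fun h' => h2 ⟨by rw [← h1]; exact e.cosetRep_of_mem h'.1, h'.2⟩]
    simp [h1, e.transfer_one]

theorem IsNormal.edgeMul_rev_edgeMul {s : 𝒢.GSeq w u} (hs : IsNormal s) (e : 𝒢.OEdge v w) :
    GSeq.edgeMul e.rev (GSeq.edgeMul e s) = s := by
  rcases edgeMul_cases e s with ⟨g, hg, s', rfl, h⟩ | ⟨a, ha, s', rfl, h⟩
  · have hs : NormalAfter e.rev s' := hs
    rw [h, edgeMul_lmul _ (e.transfer_mem hg), hs.edgeMul_eq, e.transfer_rev_transfer hg]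
    simp [GSeq.lmul]
  · rw [h, edgeMul_rev_cons _ (e.transfer_mem ha), e.transfer_rev_transfer ha]

/-- Left multiplication of a normal form by a sequence. -/
noncomputable def seqMul : ∀ {v w u : V}, 𝒢.GSeq v w → 𝒢.GSeq w u → 𝒢.GSeq v u
  | _, _, _, vert g, t => lmul g t
  | _, _, _, cons g e s, t => lmul g (edgeMul e (seqMul s t))

theorem IsNormal.seqMul {t : 𝒢.GSeq w u} (ht : IsNormal t) (s : 𝒢.GSeq v w) :
    IsNormal (seqMul s t) := by
  induction s with
  | vert g => exact ht.lmul g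
  | cons g e s ih => exact ((ih ht).edgeMul e).lmul g

theorem seqMul_lmul (g : 𝒢.vertexGroup v) (s : 𝒢.GSeq v w) (t : 𝒢.GSeq w u) :
    seqMul (lmul g s) t = lmul g (seqMul s t) := by
  cases s <;> simp only [lmul_vert, lmul_cons, seqMul, lmul_lmul]

theorem seqMul_concat {x : V} (s : 𝒢.GSeq x v) (t : 𝒢.GSeq v w) (r : 𝒢.GSeq w u) :
    seqMul (s.concat t) r = seqMul s (seqMul t r) := by
  induction s with
  | vert g => exact seqMul_lmul g t r
  | cons g e s ih => simp [concat, seqMul, ih]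

/-- Equivalent sequences act in the same way on normal forms. -/
theorem Rel.seqMul_eq {s s' : 𝒢.GSeq v w} (h : Rel s s') :
    ∀ {u : V} {t : 𝒢.GSeq w u}, IsNormal t → seqMul s t = seqMul s' t := by
  induction h with
  | slide g e g' a =>
    intro u t _
    have ha : e.inclTerm a⁻¹ ∈ e.edgeSubgroup := ⟨_, rfl⟩
    simp only [seqMul]
    rw [← lmul_lmul (e.inclTerm a⁻¹), edgeMul_lmul e ha, e.transfer_inclTerm, lmul_lmul,
      mul_assoc, ← map_mul, mul_inv_cancel, map_one, mul_one]
  | cancel g e k =>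
    intro u t ht
    simp only [seqMul, one_lmul]
    have := (ht.lmul k).edgeMul_rev_edgeMul e.rev
    rw [OEdge.rev_rev] at this
    rw [this, lmul_lmul]
  | concat _ _ ih₁ ih₂ =>
    intro u t ht
    rw [seqMul_concat, seqMul_concat, ih₂ ht, ih₁ (ht.seqMul _)]
  | refl s => intros; rfl
  | symm _ ih => intro u t ht; exact (ih ht).symm
  | trans _ _ ih₁ ih₂ => intro u t ht; exact (ih₁ ht).trans (ih₂ ht)

/-- The normal form of a sequence. -/
noncomputable def normalForm (s : 𝒢.GSeq v w) : 𝒢.GSeq v w := seqMul s (vert 1)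

theorem isNormal_normalForm (s : 𝒢.GSeq v w) : IsNormal s.normalForm :=
  (isNormal_vert 1).seqMul s

theorem Rel.normalForm_eq {s s' : 𝒢.GSeq v w} (h : Rel s s') : s.normalForm = s'.normalForm :=
  h.seqMul_eq (isNormal_vert 1)

theorem normalForm_concat (s : 𝒢.GSeq u v) (t : 𝒢.GSeq v w) :
    (s.concat t).normalForm = seqMul s t.normalForm := seqMul_concat s t _

theorem Rel.lmul {s t : 𝒢.GSeq v w} (h : Rel s t) (g : 𝒢.vertexGroup v) :
    Rel (lmul g s) (lmul g t) := Rel.concat (Rel.refl (vert g)) h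

theorem Rel.cons {x : V} {s t : 𝒢.GSeq v w} (h : Rel s t) (g : 𝒢.vertexGroup x)
    (e : 𝒢.OEdge x v) : Rel (cons g e s) (GSeq.cons g e t) := by
  simpa [GSeq.concat, one_lmul] using Rel.concat (Rel.refl (GSeq.cons g e (vert 1))) h

theorem rel_cons_lmul (e : 𝒢.OEdge v w) {a : 𝒢.vertexGroup w} (ha : a ∈ e.edgeSubgroup)
    (s : 𝒢.GSeq w u) : Rel (cons 1 e (lmul a s)) (cons (e.transfer a) e s) := by
  obtain ⟨b, rfl⟩ := ha
  have h : Rel (cons 1 e (vert (e.inclTerm b))) (cons (e.inclInit b) e (vert 1)) := by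
    simpa [← map_mul] using Rel.slide 1 e (e.inclTerm b) b
  simpa [GSeq.concat, one_lmul, e.transfer_inclTerm] using Rel.concat h (Rel.refl s)

theorem rel_edgeMul (e : 𝒢.OEdge v w) (s : 𝒢.GSeq w u) : Rel (cons 1 e s) (edgeMul e s) := by
  rcases edgeMul_cases e s with ⟨g, hg, s', rfl, h⟩ | ⟨a, ha, s', rfl, h⟩
  · rw [h]
    have h1 : Rel (cons 1 e (cons g e.rev s')) (cons (e.transfer g) e (cons 1 e.rev s')) := by
      simpa [GSeq.lmul] using rel_cons_lmul e hg (cons 1 e.rev s')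
    have h2 := Rel.concat (Rel.cancel (e.transfer g) e 1) (Rel.refl s')
    simp only [GSeq.concat, one_lmul, mul_one] at h2
    exact h1.trans h2
  · rw [h]
    exact rel_cons_lmul e ha s'

theorem rel_normalForm (s : 𝒢.GSeq v w) : Rel s s.normalForm := by
  induction s with
  | vert g => simpa [normalForm, seqMul, lmul] using Rel.refl _
  | cons g e s ih =>
    have h1 := (ih.cons 1 e).trans (rel_edgeMul e s.normalForm)
    have h2 := h1.lmul g
    rwa [lmul_cons, mul_one] at h2

theorem edgeCount_edgeMul (e : 𝒢.OEdge v w) (s : 𝒢.GSeq w u) :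
    (edgeMul e s).edgeCount = s.edgeCount + 1 ∨ s.edgeCount = (edgeMul e s).edgeCount + 1 := by
  rcases edgeMul_cases e s with ⟨g, hg, s', rfl, h⟩ | ⟨a, ha, s', rfl, h⟩ <;> rw [h] <;>
    simp [edgeCount_lmul, edgeCount]

theorem edgeCount_normalForm_le (s : 𝒢.GSeq v w) : s.normalForm.edgeCount ≤ s.edgeCount := by
  induction s with
  | vert g => exact Nat.zero_le _
  | cons g e s ih =>
    change (GSeq.lmul g (edgeMul e s.normalForm)).edgeCount ≤ s.edgeCount + 1
    rw [edgeCount_lmul]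
    have := edgeCount_edgeMul e s.normalForm
    omega

end GSeq

end GraphOfGroups

/-! ### The fundamental groupoid and its edge length -/

namespace GraphOfGroups

variable {V : Type u₁} {E : Type u₂} {𝒢 : GraphOfGroups.{u₁, u₂, u₃, u₄} V E} {a b c u v w x : V}

/-- Equivalence of sequences from `v` to `w`, as a setoid. -/
def seqSetoid (𝒢 : GraphOfGroups.{u₁, u₂, u₃, u₄} V E) (v w : V) : Setoid (𝒢.GSeq v w) where
  r := GSeq.Rel
  iseqv := ⟨GSeq.Rel.refl, GSeq.Rel.symm, GSeq.Rel.trans⟩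

/-- The morphisms from `v` to `w` of the fundamental groupoid: the equivalence classes of
sequences from `v` to `w`. For `v = w` this is the underlying type of the fundamental group. -/
def Path (𝒢 : GraphOfGroups.{u₁, u₂, u₃, u₄} V E) (v w : V) : Type (max u₁ u₂ u₃) :=
  Quotient (seqSetoid 𝒢 v w)

namespace Path

/-- The class of a sequence. -/
def mk (s : 𝒢.GSeq v w) : 𝒢.Path v w := Quotient.mk (seqSetoid 𝒢 v w) s

/-- Composition in the fundamental groupoid, induced by concatenation. -/
def comp (p : 𝒢.Path u v) (q : 𝒢.Path v w) : 𝒢.Path u w :=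
  Quotient.map₂ GSeq.concat (fun _ _ h _ _ h' => GSeq.Rel.concat h h') p q

/-- The inverse in the fundamental groupoid. -/
def inv (p : 𝒢.Path v w) : 𝒢.Path w v := Quotient.map GSeq.inv (fun _ _ h => GSeq.Rel.inv h) p

/-- The class of the sequence consisting of one vertex element. -/
def ofVertex (g : 𝒢.vertexGroup v) : 𝒢.Path v v := mk (GSeq.vert g)

/-- The class of a single edge. -/
def ofEdge (e : 𝒢.OEdge v w) : 𝒢.Path v w := mk (GSeq.cons 1 e (GSeq.vert 1))

end Path

/-- Composition in the fundamental groupoid, in diagrammatic order. -/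
notation:80 p:81 " ⬝ " q:80 => Path.comp p q

namespace Path

theorem mk_surjective (p : 𝒢.Path v w) : ∃ s, mk s = p := Quotient.exists_rep p

theorem mk_eq_mk {s t : 𝒢.GSeq v w} : mk s = mk t ↔ GSeq.Rel s t :=
  ⟨fun h => Quotient.exact h, fun h => Quotient.sound h⟩

theorem mk_concat (s : 𝒢.GSeq u v) (t : 𝒢.GSeq v w) : mk (s.concat t) = mk s ⬝ mk t := rfl

theorem mk_inv (s : 𝒢.GSeq v w) : mk s.inv = (mk s).inv := rfl

theorem mk_cons (g : 𝒢.vertexGroup u) (e : 𝒢.OEdge u v) (s : 𝒢.GSeq v w) :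
    mk (GSeq.cons g e s) = (ofVertex g ⬝ ofEdge e) ⬝ mk s := by
  simp only [ofVertex, ofEdge, ← mk_concat, GSeq.concat, GSeq.lmul_cons, mul_one, GSeq.one_lmul]

theorem assoc (p : 𝒢.Path a b) (q : 𝒢.Path b c) (r : 𝒢.Path c u) :
    (p ⬝ q) ⬝ r = p ⬝ (q ⬝ r) := by
  obtain ⟨s, rfl⟩ := mk_surjective p
  obtain ⟨t, rfl⟩ := mk_surjective q
  obtain ⟨k, rfl⟩ := mk_surjective r
  exact congrArg mk (GSeq.concat_assoc s t k)

theorem one_comp (p : 𝒢.Path v w) : ofVertex 1 ⬝ p = p := by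
  obtain ⟨s, rfl⟩ := mk_surjective p
  exact congrArg mk (GSeq.one_lmul s)

theorem comp_one (p : 𝒢.Path v w) : p ⬝ ofVertex 1 = p := by
  obtain ⟨s, rfl⟩ := mk_surjective p
  exact congrArg mk (GSeq.concat_one s)

theorem inv_comp_self (p : 𝒢.Path v w) : p.inv ⬝ p = ofVertex 1 := by
  obtain ⟨s, rfl⟩ := mk_surjective p
  exact Quotient.sound (GSeq.inv_concat_self s)

theorem inv_inv (p : 𝒢.Path v w) : p.inv.inv = p := by
  rw [← comp_one p.inv.inv, ← inv_comp_self p, ← assoc, inv_comp_self, one_comp]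

theorem comp_inv_self (p : 𝒢.Path v w) : p ⬝ p.inv = ofVertex 1 := by
  simpa only [inv_inv] using inv_comp_self p.inv

theorem inv_comp_comp (p : 𝒢.Path v w) (q : 𝒢.Path w u) : p.inv ⬝ p ⬝ q = q := by
  rw [← assoc, inv_comp_self, one_comp]

theorem comp_inv_comp (p : 𝒢.Path v w) (q : 𝒢.Path v u) : p ⬝ p.inv ⬝ q = q := by
  rw [← assoc, comp_inv_self, one_comp]

theorem inv_comp (p : 𝒢.Path u v) (q : 𝒢.Path v w) : (p ⬝ q).inv = q.inv ⬝ p.inv := by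
  obtain ⟨s, rfl⟩ := mk_surjective p
  obtain ⟨t, rfl⟩ := mk_surjective q
  exact congrArg mk (GSeq.inv_concat s t)

theorem ofVertex_mul (g h : 𝒢.vertexGroup v) : ofVertex (g * h) = ofVertex g ⬝ ofVertex h := rfl

theorem ofVertex_inv (g : 𝒢.vertexGroup v) : ofVertex g⁻¹ = (ofVertex g).inv := rfl

/-- The edge length of a morphism: the least number of edges of a sequence representing it. In
terms of the Bass–Serre tree, `(p.inv ⬝ q).depth` is the distance of the vertices `p 𝒢_v` and
`q 𝒢_w`. -/
noncomputable def depth (p : 𝒢.Path v w) : ℕ :=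
  Quotient.lift (fun s : 𝒢.GSeq v w => s.normalForm.edgeCount)
    (fun _ _ h => congrArg GSeq.edgeCount (GSeq.Rel.normalForm_eq h)) p

theorem depth_mk (s : 𝒢.GSeq v w) : (mk s).depth = s.normalForm.edgeCount := rfl

theorem depth_mk_le (s : 𝒢.GSeq v w) : (mk s).depth ≤ s.edgeCount := s.edgeCount_normalForm_le

theorem exists_normal (p : 𝒢.Path v w) :
    ∃ s : 𝒢.GSeq v w, mk s = p ∧ s.IsNormal ∧ s.normalForm = s ∧ s.edgeCount = p.depth := by
  obtain ⟨s, rfl⟩ := mk_surjective p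
  exact ⟨s.normalForm, mk_eq_mk.2 s.rel_normalForm.symm, s.isNormal_normalForm,
    s.rel_normalForm.symm.normalForm_eq, rfl⟩

theorem depth_ofVertex (g : 𝒢.vertexGroup v) : (ofVertex g).depth = 0 := rfl

theorem depth_comp_le (p : 𝒢.Path u v) (q : 𝒢.Path v w) :
    (p ⬝ q).depth ≤ p.depth + q.depth := by
  obtain ⟨s, rfl, -, -, hs⟩ := exists_normal p
  obtain ⟨t, rfl, -, -, ht⟩ := exists_normal q
  rw [← hs, ← ht, ← GSeq.edgeCount_concat]
  exact depth_mk_le (s.concat t)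

theorem depth_inv (p : 𝒢.Path v w) : p.inv.depth = p.depth := by
  have key {v w : V} (p : 𝒢.Path v w) : p.inv.depth ≤ p.depth := by
    obtain ⟨s, rfl, -, -, hs⟩ := exists_normal p
    rw [← hs, ← s.edgeCount_inv]
    exact depth_mk_le s.inv
  refine le_antisymm (key p) ?_
  simpa only [inv_inv] using key p.inv

theorem ofVertex_injective : Function.Injective (ofVertex : 𝒢.vertexGroup v → 𝒢.Path v v) := by
  intro g h hgh
  have : (GSeq.vert g).normalForm = (GSeq.vert h).normalForm := (mk_eq_mk.1 hgh).normalForm_eq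
  simpa [GSeq.normalForm, GSeq.seqMul, GSeq.lmul_vert] using this

theorem eq_of_depth_eq_zero {p : 𝒢.Path v w} (hp : p.depth = 0) : v = w := by
  obtain ⟨s, rfl, -, -, hs⟩ := exists_normal p
  cases s with
  | vert g => rfl
  | cons g e s => simp [GSeq.edgeCount, hp] at hs

theorem exists_ofVertex {p : 𝒢.Path v v} (hp : p.depth = 0) : ∃ g, p = ofVertex g := by
  obtain ⟨s, rfl, -, -, hs⟩ := exists_normal p
  cases s with
  | vert g => exact ⟨g, rfl⟩
  | cons g e s => simp [GSeq.edgeCount, hp] at hs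

theorem exists_first_edge {p : 𝒢.Path v w} {n : ℕ} (hp : p.depth = n + 1) :
    ∃ (u : V) (q : 𝒢.Path v u) (r : 𝒢.Path u w), p = q ⬝ r ∧ q.depth = 1 ∧ r.depth = n := by
  obtain ⟨s, rfl, -, -, hs⟩ := exists_normal p
  cases s with
  | vert g => simp [GSeq.edgeCount, hp] at hs
  | @cons _ u _ g e s =>
    have h0 := mk_cons g e s
    have h1 : (ofVertex g ⬝ ofEdge e).depth ≤ 1 := depth_mk_le (GSeq.cons (g * 1) e (GSeq.vert 1))
    have h2 := depth_mk_le s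
    have h3 := depth_comp_le (ofVertex g ⬝ ofEdge e) (mk s)
    rw [← h0] at h3
    simp only [GSeq.edgeCount] at hs
    exact ⟨u, _, _, h0, by omega, by omega⟩

theorem exists_eq_cons {p : 𝒢.Path v w} (hp : p.depth = 1) :
    ∃ g e h, p = mk (GSeq.cons g e (GSeq.vert h)) := by
  obtain ⟨s, rfl, -, -, hs⟩ := exists_normal p
  rw [hp] at hs
  rcases s with _ | ⟨g, e, s⟩
  · simp [GSeq.edgeCount] at hs
  · rcases s with h | ⟨g', e', s⟩
    · exact ⟨g, e, h, rfl⟩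
    · simp [GSeq.edgeCount] at hs

/-- The distances of two neighbouring vertices of the Bass–Serre tree from any vertex differ by
exactly one. -/
theorem depth_comp_of_depth_eq_one {p : 𝒢.Path u v} (hp : p.depth = 1) (q : 𝒢.Path v w) :
    (p ⬝ q).depth = q.depth + 1 ∨ q.depth = (p ⬝ q).depth + 1 := by
  obtain ⟨g, e, h, rfl⟩ := exists_eq_cons hp
  obtain ⟨t, rfl⟩ := mk_surjective q
  rw [← mk_concat, depth_mk, depth_mk, GSeq.normalForm_concat]
  simp only [GSeq.seqMul, GSeq.edgeCount_lmul]
  simpa only [GSeq.edgeCount_lmul] using GSeq.edgeCount_edgeMul e (GSeq.lmul h t.normalForm)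

/-- If removing the one-edge morphism `p` shortens a normal form, then the normal form begins
with the edge of `p`. -/
theorem exists_eq_cons_of_depth_lt {p : 𝒢.Path v w} (hp : p.depth = 1) {t : 𝒢.GSeq v u}
    (ht : t.normalForm = t) (h : (mk t).depth = (p.inv ⬝ mk t).depth + 1) :
    ∃ (g : 𝒢.vertexGroup v) (e : 𝒢.OEdge v w) (k : 𝒢.vertexGroup w),
      p = mk (GSeq.cons g e (GSeq.vert k)) ∧
      ∃ d ∈ e.rev.edgeSubgroup, ∃ t', t = GSeq.cons (g * d) e t' := by
  obtain ⟨g, e, k, rfl⟩ := exists_eq_cons hp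
  refine ⟨g, e, k, rfl, ?_⟩
  rw [← mk_inv, ← mk_concat, depth_mk, depth_mk, GSeq.normalForm_concat, ht] at h
  simp only [GSeq.inv, GSeq.concat, GSeq.lmul_cons, GSeq.seqMul, GSeq.edgeCount_lmul] at h
  have ht' : t = GSeq.lmul g (GSeq.lmul g⁻¹ t) := by
    rw [GSeq.lmul_lmul, mul_inv_cancel, GSeq.one_lmul]
  rcases GSeq.edgeMul_cases e.rev (GSeq.lmul g⁻¹ t) with ⟨d, hd, s', h1, h2⟩ | ⟨d, hd, s', h1, h2⟩
  · refine ⟨d, hd, s', ?_⟩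
    rw [ht', h1, OEdge.rev_rev, GSeq.lmul_cons]
  · rw [h2, GSeq.edgeCount, ← GSeq.edgeCount_lmul g⁻¹ t, h1, GSeq.edgeCount_lmul] at h
    omega

/-- A vertex of the Bass–Serre tree has only one neighbour that is closer to a given vertex. -/
theorem depth_inv_comp_eq_zero {p : 𝒢.Path v a} {q : 𝒢.Path v b} {x : 𝒢.Path a w}
    {y : 𝒢.Path b w} (hp : p.depth = 1) (hq : q.depth = 1) (h : p ⬝ x = q ⬝ y)
    (hx : (p ⬝ x).depth = x.depth + 1) (hy : (p ⬝ x).depth = y.depth + 1) :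
    (p.inv ⬝ q).depth = 0 := by
  obtain ⟨t, ht, -, htn, -⟩ := exists_normal (p ⬝ x)
  have h1 : (mk t).depth = (p.inv ⬝ mk t).depth + 1 := by rw [ht, inv_comp_comp, hx]
  have h2 : (mk t).depth = (q.inv ⬝ mk t).depth + 1 := by
    rw [ht, hy, h, inv_comp_comp]
  obtain ⟨g, e, k, rfl, d, hd, t', rfl⟩ := exists_eq_cons_of_depth_lt hp htn h1
  obtain ⟨g', e', k', rfl, d', hd', t'', h3⟩ := exists_eq_cons_of_depth_lt hq htn h2
  obtain ⟨rfl, hg, he, -⟩ := GSeq.cons.inj h3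
  obtain rfl := eq_of_heq he
  have h4 : g⁻¹ * g' = d * d'⁻¹ := by
    rw [eq_mul_inv_iff_mul_eq, mul_assoc, inv_mul_eq_iff_eq_mul]
    exact hg.symm
  have hmem : d * d'⁻¹ ∈ e.rev.edgeSubgroup := mul_mem hd (inv_mem hd')
  rw [← mk_inv, ← mk_concat]
  have h5 : (GSeq.cons g e (GSeq.vert k)).inv.concat (GSeq.cons g' e (GSeq.vert k')) =
      GSeq.lmul k⁻¹ (GSeq.cons 1 e.rev (GSeq.cons (d * d'⁻¹) e (GSeq.vert k'))) := by
    simp [GSeq.inv, GSeq.concat, GSeq.lmul_cons, h4]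
  have h6 := (GSeq.rel_edgeMul e.rev (GSeq.cons (d * d'⁻¹) e (GSeq.vert k'))).lmul k⁻¹
  rw [GSeq.edgeMul_rev_cons e hmem, ← h5] at h6
  rw [mk_eq_mk.2 h6]
  exact Nat.le_zero.1 (depth_mk_le _)

end Path

end GraphOfGroups

/-! ### Geodesics in the Bass–Serre tree -/

namespace GraphOfGroups

variable {V : Type u₁} {E : Type u₂} {𝒢 : GraphOfGroups.{u₁, u₂, u₃, u₄} V E} {a b c u v w x : V}

namespace Path

theorem depth_comp_of_depth_eq_zero {k : 𝒢.Path u v} (hk : k.depth = 0) (p : 𝒢.Path v w) :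
    (k ⬝ p).depth = p.depth := by
  have h1 := depth_comp_le k p
  have h2 := depth_comp_le k.inv (k ⬝ p)
  rw [inv_comp_comp, depth_inv] at h2
  omega

theorem depth_comp_of_depth_eq_zero_right (p : 𝒢.Path u v) {k : 𝒢.Path v w} (hk : k.depth = 0) :
    (p ⬝ k).depth = p.depth := by
  rw [← depth_inv, inv_comp, depth_comp_of_depth_eq_zero (by rwa [depth_inv]), depth_inv]

/-- A geodesic has only one vertex at a given distance from its origin: `x 𝒢_a` and `x' 𝒢_b`
coincide if both lie on the geodesic from `𝒢_v` to `x ⬝ y 𝒢_w`, at the same distance. -/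
theorem depth_inv_comp_eq_zero_of_geodesic (n : ℕ) : ∀ {v a b w : V} {x : 𝒢.Path v a}
    {y : 𝒢.Path a w} {x' : 𝒢.Path v b} {y' : 𝒢.Path b w}, x ⬝ y = x' ⬝ y' →
    (x ⬝ y).depth = x.depth + y.depth → (x ⬝ y).depth = x'.depth + y'.depth →
    x.depth = n → x'.depth = n → (x.inv ⬝ x').depth = 0 := by
  induction n with
  | zero =>
    intro v a b w x y x' y' _ _ _ hx hx'
    rw [depth_comp_of_depth_eq_zero (by rwa [depth_inv]), hx']
  | succ n ih =>
    intro v a b w x y x' y' h h1 h2 hx hx'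
    obtain ⟨c, p, r, rfl, hp, hr⟩ := exists_first_edge hx
    obtain ⟨c', p', r', rfl, hp', hr'⟩ := exists_first_edge hx'
    have t1 := depth_comp_le r y
    have t2 := depth_comp_le r' y'
    have t3 := depth_comp_le p (r ⬝ y)
    have t4 := depth_comp_le p' (r' ⬝ y')
    rw [assoc] at h h1 h2
    rw [assoc] at h
    rw [← h] at t4
    have hk := depth_inv_comp_eq_zero hp hp' h (by omega) (by omega)
    have e1 : r ⬝ y = ((p.inv ⬝ p') ⬝ r') ⬝ y' := by
      rw [assoc, assoc, ← h, inv_comp_comp]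
    have e2 := depth_comp_of_depth_eq_zero hk r'
    have := ih e1 (by omega) (by omega) hr (by omega)
    rwa [inv_comp, assoc, ← assoc p.inv]

/-- The three vertices `𝒢_a`, `p 𝒢_b` and `p ⬝ q 𝒢_c` of the Bass–Serre tree have a median: a
vertex `x 𝒢_d` that lies on the geodesics between any two of them. -/
theorem exists_median (n : ℕ) : ∀ {a b c : V} (p : 𝒢.Path a b) (q : 𝒢.Path b c), p.depth = n →
    ∃ (d : V) (x : 𝒢.Path a d) (y : 𝒢.Path d b) (z : 𝒢.Path d c), p = x ⬝ y ∧ q = y.inv ⬝ z ∧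
      p.depth = x.depth + y.depth ∧ q.depth = y.depth + z.depth ∧
      (p ⬝ q).depth = x.depth + z.depth := by
  induction n with
  | zero =>
    intro a b c p q hp
    refine ⟨a, ofVertex 1, p, p ⬝ q, (one_comp p).symm, (inv_comp_comp p q).symm, ?_, ?_, ?_⟩
    · rw [depth_ofVertex, zero_add]
    · rw [hp, zero_add, depth_comp_of_depth_eq_zero hp]
    · rw [depth_ofVertex, zero_add]
  | succ n ih =>
    intro a b c p q hp
    -- `p` is split as `p' ⬝ e` with a last edge `e`
    obtain ⟨b', e₁, p₁, hpe, he₁, hp₁⟩ := exists_first_edge (p := p.inv) (by rwa [depth_inv])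
    obtain ⟨p', rfl⟩ : ∃ p', p₁ = p'.inv := ⟨p₁.inv, (inv_inv _).symm⟩
    obtain ⟨e, rfl⟩ : ∃ e, e₁ = e.inv := ⟨e₁.inv, (inv_inv _).symm⟩
    rw [← inv_comp] at hpe
    obtain rfl : p = p' ⬝ e := by rw [← inv_inv p, hpe, inv_inv]
    rw [depth_inv] at he₁ hp₁
    obtain ⟨d, x, y, z, rfl, hq, h1, h2, h3⟩ := ih p' (e ⬝ q) hp₁
    rw [← assoc] at h3
    rcases depth_comp_of_depth_eq_one he₁ q with h4 | h4
    · -- the edge `e` leads towards the end of `q`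
      by_cases hy : y.depth = 0
      · refine ⟨b, (x ⬝ y) ⬝ e, ofVertex 1, q, (comp_one _).symm, ?_, ?_, ?_, ?_⟩
        · rw [← ofVertex_inv, inv_one, one_comp]
        · rw [depth_ofVertex, add_zero]
        · rw [depth_ofVertex, zero_add]
        · omega
      · -- otherwise `e` would lead towards the origin of `p`
        exfalso
        obtain ⟨m, hm⟩ := Nat.exists_eq_succ_of_ne_zero hy
        obtain ⟨f, g, r, hgr, hg, hr⟩ := exists_first_edge (p := y.inv) (n := m)
          (by rwa [depth_inv])
        have h5 : e ⬝ q = g ⬝ r ⬝ z := by rw [hq, hgr, assoc]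
        have t1 := depth_comp_le g (r ⬝ z)
        have t2 := depth_comp_le r z
        rw [← h5] at t1
        have hk := depth_inv_comp_eq_zero he₁ hg h5 h4 (by omega)
        have h6 : (x ⬝ y) ⬝ e = (x ⬝ r.inv) ⬝ (g.inv ⬝ e) := by
          have : y = r.inv ⬝ g.inv := by rw [← inv_inv y, hgr, inv_comp]
          rw [this, assoc, assoc, assoc]
        have hk' : (g.inv ⬝ e).depth = 0 := by rw [← depth_inv, inv_comp, inv_inv, hk]
        have t3 := depth_comp_le x r.inv
        rw [h6, depth_comp_of_depth_eq_zero_right _ hk'] at hp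
        rw [depth_inv] at t3
        omega
    · have h5 : q = (y ⬝ e).inv ⬝ z := by
        rw [inv_comp, assoc, ← hq, inv_comp_comp]
      have t1 := depth_comp_le x (y ⬝ e)
      have t2 := depth_comp_le y e
      rw [← assoc] at t1
      refine ⟨d, x, y ⬝ e, z, assoc _ _ _, h5, ?_, ?_, h3⟩
      · omega
      · omega

/-- An edge path in the Bass–Serre tree passes through every vertex of the geodesic between its
ends: an initial part of the sequence `s` ends at the vertex `x 𝒢_a`. -/
theorem exists_length_le (S : ∀ v, Set (𝒢.vertexGroup v)) {v w : V} (s : 𝒢.GSeq v w) :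
    ∀ {a : V} (x : 𝒢.Path v a) (y : 𝒢.Path a w), mk s = x ⬝ y →
      (x ⬝ y).depth = x.depth + y.depth →
      ∃ (b : V) (t : 𝒢.GSeq v b), t.length S ≤ s.length S ∧ ((mk t).inv ⬝ x).depth = 0 := by
  induction s with
  | @vert v g =>
    intro a x y h h1
    refine ⟨v, GSeq.vert g, le_rfl, ?_⟩
    have h2 : (x ⬝ y).depth = 0 := by rw [← h]; exact depth_ofVertex g
    rw [depth_comp_of_depth_eq_zero (by rw [depth_inv]; exact depth_ofVertex g)]
    omega
  | @cons v u w g e s ih =>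
    intro a x y h h1
    have hp : (ofVertex g ⬝ ofEdge e).depth = 1 := rfl
    rw [mk_cons] at h
    generalize hpe : ofVertex g ⬝ ofEdge e = p at h hp
    have step {b : V} (t : 𝒢.GSeq u b) (ht : t.length S ≤ s.length S)
        (h2 : ((mk t).inv ⬝ p.inv ⬝ x).depth = 0) : ∃ (b : V) (t : 𝒢.GSeq v b),
        t.length S ≤ (GSeq.cons g e s).length S ∧ ((mk t).inv ⬝ x).depth = 0 := by
      refine ⟨b, GSeq.cons g e t, Nat.add_le_add_left ht _, ?_⟩
      rwa [mk_cons, hpe, inv_comp, assoc]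
    rcases depth_comp_of_depth_eq_one hp (mk s) with h2 | h2
    · rcases Nat.eq_zero_or_pos x.depth with hx | hx
      · -- `x` leads to the origin itself
        refine ⟨v, GSeq.vert g, ?_, ?_⟩
        · simp only [GSeq.length]; omega
        · rwa [depth_comp_of_depth_eq_zero (by rw [depth_inv]; exact depth_ofVertex g)]
      · -- the first edge of `s` is the first edge of the geodesic
        obtain ⟨m, hm⟩ := Nat.exists_eq_succ_of_ne_zero hx.ne'
        obtain ⟨f, p', x', rfl, hp', hx'⟩ := exists_first_edge hm
        rw [assoc] at h h1
        have t1 := depth_comp_le p' (x' ⬝ y)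
        have t2 := depth_comp_le x' y
        rw [← h] at t1 h1
        have hk := depth_inv_comp_eq_zero hp hp' h h2 (by omega)
        have h3 : mk s = ((p.inv ⬝ p') ⬝ x') ⬝ y := by
          rw [assoc, assoc, ← h, inv_comp_comp]
        have h4 := depth_comp_of_depth_eq_zero hk x'
        obtain ⟨b, t, ht, h5⟩ := ih _ _ h3 (by rw [← h3]; omega)
        exact step t ht (by rwa [assoc] at h5)
    · -- the first edge of `s` leads away from the end, so the rest of `s` has to come back
      -- through the origin
      have h3 : mk s = (p.inv ⬝ x) ⬝ y := by rw [assoc, ← h, inv_comp_comp]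
      have t1 := depth_comp_le p.inv x
      have t2 := depth_comp_le (p.inv ⬝ x) y
      rw [depth_inv] at t1
      rw [← h3] at t2
      rw [h] at h2
      obtain ⟨b, t, ht, h5⟩ := ih _ _ h3 (by rw [← h3]; omega)
      exact step t ht h5

end Path

end GraphOfGroups

/-! ### Rapid Decay as a trilinear inequality -/


section Analysis

variable {α : Type*} {G : Type u} [Group G]

/-- The `ℓ²`-norm of a function with values in `[0, ∞]`. -/
noncomputable def l2norm (f : α → ℝ≥0∞) : ℝ≥0∞ := (∑' x, f x ^ 2) ^ (1 / 2 : ℝ)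

theorem l2norm_sq (f : α → ℝ≥0∞) : l2norm f ^ 2 = ∑' x, f x ^ 2 := by
  rw [l2norm, ← ENNReal.rpow_natCast, ← ENNReal.rpow_mul]
  norm_num

theorem l2norm_le_iff {f : α → ℝ≥0∞} {y : ℝ≥0∞} : l2norm f ≤ y ↔ ∑' x, f x ^ 2 ≤ y ^ 2 := by
  rw [← l2norm_sq]
  exact (ENNReal.pow_le_pow_left_iff two_ne_zero).symm

theorem tsum_mul_le_l2norm_mul_l2norm (f g : α → ℝ≥0∞) :
    ∑' x, f x * g x ≤ l2norm f * l2norm g := by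
  let _ : MeasurableSpace α := ⊤
  have := ENNReal.lintegral_mul_le_Lp_mul_Lq (MeasureTheory.Measure.count (α := α))
    Real.HolderConjugate.two_two (f := f) (g := g) measurable_from_top.aemeasurable
    measurable_from_top.aemeasurable
  simpa [MeasureTheory.lintegral_count, l2norm] using this

/-- If `h ≤ f ∘ j`, and `j` is injective where `h` does not vanish, then the `ℓ²`-norm of `h` is
at most that of `f`. -/
theorem l2norm_le_of_injOn {ι : Type*} (f : α → ℝ≥0∞) (h : ι → ℝ≥0∞) (j : ι → α)
    (hj : Set.InjOn j {i | h i ≠ 0}) (hh : ∀ i, h i ≤ f (j i)) : l2norm h ≤ l2norm f := by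
  rw [l2norm_le_iff, l2norm_sq]
  have h1 : ∑' i, h i ^ 2 = ∑' i : {i | h i ≠ 0}, h i ^ 2 := by
    refine (tsum_subtype_eq_of_support_subset fun i hi => ?_).symm
    intro h0
    simp [h0] at hi
  rw [h1]
  calc ∑' i : {i | h i ≠ 0}, h i ^ 2 ≤ ∑' i : {i | h i ≠ 0}, f (j i) ^ 2 :=
        ENNReal.tsum_le_tsum fun i => pow_le_pow_left₀ zero_le (hh i) 2
    _ ≤ ∑' x, f x ^ 2 :=
        ENNReal.tsum_comp_le_tsum_of_injective (f := fun i : {i | h i ≠ 0} => j i)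
          (Set.injOn_iff_injective.1 hj) (fun x => f x ^ 2)

theorem ell2Norm_nonneg {X : Type*} (f : MonoidAlgebra ℝ≥0 X) : 0 ≤ ell2Norm f :=
  Real.sqrt_nonneg _

theorem l2norm_coeff {X : Type*} (f : MonoidAlgebra ℝ≥0 X) :
    l2norm (fun x => (f.coeff x : ℝ≥0∞)) = ENNReal.ofReal (ell2Norm f) := by
  rw [l2norm, tsum_eq_sum (s := f.coeff.support) (by
    intro x hx
    simp [Finsupp.notMem_support_iff.1 hx]), ell2Norm, Real.sqrt_eq_rpow,
    ← ENNReal.ofReal_rpow_of_nonneg (Finset.sum_nonneg fun _ _ => sq_nonneg _) (by norm_num),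
    ENNReal.ofReal_sum_of_nonneg fun _ _ => sq_nonneg _]
  congr 1
  refine Finset.sum_congr rfl fun x _ => ?_
  rw [ENNReal.ofReal_pow (NNReal.coe_nonneg _), ENNReal.ofReal_coe_nnreal]

open Classical in
theorem coeff_mul_eq_tsum (f g : MonoidAlgebra ℝ≥0 G) (c : G) :
    ((f * g).coeff c : ℝ≥0∞) =
      ∑' a, ∑' b, if c = a * b then (f.coeff a * g.coeff b : ℝ≥0∞) else 0 := by
  rw [MonoidAlgebra.coeff_mul, Finsupp.sum, ENNReal.ofNNReal_finsetSum,
    tsum_eq_sum (s := f.coeff.support) (by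
      intro x hx
      simp [Finsupp.notMem_support_iff.1 hx])]
  refine Finset.sum_congr rfl fun a _ => ?_
  rw [Finsupp.sum, ENNReal.ofNNReal_finsetSum, tsum_eq_sum (s := g.coeff.support) (by
      intro x hx
      simp [Finsupp.notMem_support_iff.1 hx])]
  refine Finset.sum_congr rfl fun b _ => ?_
  simp only [eq_comm (a := c)]
  split_ifs <;> simp

theorem tsum_coeff_mul_mul (f g : MonoidAlgebra ℝ≥0 G) (k : G → ℝ≥0∞) :
    ∑' c, ((f * g).coeff c : ℝ≥0∞) * k c =
      ∑' a, ∑' b, (f.coeff a * g.coeff b * k (a * b) : ℝ≥0∞) := by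
  classical
  simp_rw [coeff_mul_eq_tsum, ← ENNReal.tsum_mul_right]
  rw [ENNReal.tsum_comm]
  refine tsum_congr fun a => ?_
  rw [ENNReal.tsum_comm]
  refine tsum_congr fun b => ?_
  rw [tsum_eq_single (a * b) (fun c hc => by simp [hc])]
  simp

/-- The trilinear form of the Rapid Decay inequality. -/
theorem tsum_le_of_ell2Norm_le {C : ℝ} {f g : MonoidAlgebra ℝ≥0 G}
    (h : ell2Norm (f * g) ≤ C * ell2Norm f * ell2Norm g) (k : G → ℝ≥0∞) :
    ∑' a, ∑' b, (f.coeff a * g.coeff b * k (a * b) : ℝ≥0∞) ≤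
      ENNReal.ofReal C * l2norm (fun a => (f.coeff a : ℝ≥0∞)) *
        l2norm (fun a => (g.coeff a : ℝ≥0∞)) * l2norm k := by
  rw [← tsum_coeff_mul_mul]
  refine (tsum_mul_le_l2norm_mul_l2norm _ k).trans ?_
  gcongr
  rw [l2norm_coeff, l2norm_coeff, l2norm_coeff,
    ← ENNReal.ofReal_mul' (ell2Norm_nonneg _), ← ENNReal.ofReal_mul' (ell2Norm_nonneg _)]
  exact ENNReal.ofReal_le_ofReal h

theorem ell2Norm_le_of_tsum_le {C : ℝ} (hC : 0 ≤ C) {f g : MonoidAlgebra ℝ≥0 G}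
    (h : ∀ k : G → ℝ≥0∞, ∑' a, ∑' b, (f.coeff a * g.coeff b * k (a * b) : ℝ≥0∞) ≤
      ENNReal.ofReal C * l2norm (fun a => (f.coeff a : ℝ≥0∞)) *
        l2norm (fun a => (g.coeff a : ℝ≥0∞)) * l2norm k) :
    ell2Norm (f * g) ≤ C * ell2Norm f * ell2Norm g := by
  have h1 := h fun c => ((f * g).coeff c : ℝ≥0∞)
  rw [← tsum_coeff_mul_mul f g fun c => ((f * g).coeff c : ℝ≥0∞)] at h1
  simp_rw [← pow_two] at h1
  rw [← l2norm_sq, l2norm_coeff, l2norm_coeff, l2norm_coeff,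
    ← ENNReal.ofReal_mul' (ell2Norm_nonneg _), ← ENNReal.ofReal_mul' (ell2Norm_nonneg _),
    ← ENNReal.ofReal_mul' (ell2Norm_nonneg _), ← ENNReal.ofReal_pow (ell2Norm_nonneg _)] at h1
  have n1 := ell2Norm_nonneg f
  have n2 := ell2Norm_nonneg g
  have n3 := ell2Norm_nonneg (f * g)
  rw [ENNReal.ofReal_le_ofReal_iff (by positivity), pow_two] at h1
  rcases n3.eq_or_lt with h0 | h0
  · rw [← h0]; positivity
  · exact le_of_mul_le_mul_right h1 h0

theorem l2norm_prod {β : Type*} (f : α × β → ℝ≥0∞) :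
    l2norm f = l2norm fun a => l2norm fun b => f (a, b) := by
  refine le_antisymm ?_ ?_ <;> rw [l2norm_le_iff] <;>
    simp only [l2norm_sq, ENNReal.tsum_prod', le_refl]

theorem l2norm_swap {β : Type*} (f : α × β → ℝ≥0∞) :
    l2norm (fun p : β × α => f p.swap) = l2norm f := by
  rw [l2norm, l2norm]
  congr 1
  exact (Equiv.prodComm β α).tsum_eq fun p => f p ^ 2

/-- The Cauchy–Schwarz inequality for three matrices. -/
theorem tsum_mul_mul_le {A B D : Type*} (x : A → B → ℝ≥0∞) (y : B → D → ℝ≥0∞)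
    (z : A → D → ℝ≥0∞) :
    ∑' (a) (b) (d), x a b * y b d * z a d ≤ l2norm (fun p : A × B => x p.1 p.2) *
      l2norm (fun p : B × D => y p.1 p.2) * l2norm (fun p : A × D => z p.1 p.2) := by
  have h1 : ∑' (a) (b) (d), x a b * y b d * z a d =
      ∑' p : A × D, (∑' b, x p.1 b * y b p.2) * z p.1 p.2 := by
    rw [ENNReal.tsum_prod']
    refine tsum_congr fun a => ?_
    rw [ENNReal.tsum_comm]
    simp_rw [ENNReal.tsum_mul_right]
  rw [h1]
  refine (tsum_mul_le_l2norm_mul_l2norm _ _).trans ?_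
  gcongr
  rw [l2norm_prod, ← l2norm_swap (fun p : B × D => y p.1 p.2), l2norm_prod (α := D),
    l2norm_prod (α := A), l2norm_le_iff, mul_pow, l2norm_sq, l2norm_sq, ← ENNReal.tsum_mul_right]
  refine ENNReal.tsum_le_tsum fun a => ?_
  rw [l2norm_sq, ← ENNReal.tsum_mul_left]
  refine ENNReal.tsum_le_tsum fun d => ?_
  rw [← mul_pow]
  exact pow_le_pow_left₀ zero_le (tsum_mul_le_l2norm_mul_l2norm _ _) 2

/-- The Rapid Decay inequality of a group passes to matrices with entries in its group algebra. -/
theorem tsum_matrix_le {A B D : Type*} {C : ℝ≥0∞} (F : A → B → G → ℝ≥0∞) (K : B → D → G → ℝ≥0∞)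
    (k : A → D → G → ℝ≥0∞)
    (h : ∀ a b d, ∑' (g) (g'), F a b g * K b d g' * k a d (g * g') ≤
      C * l2norm (F a b) * l2norm (K b d) * l2norm (k a d)) :
    ∑' (a) (b) (d) (g) (g'), F a b g * K b d g' * k a d (g * g') ≤
      C * l2norm (fun p : (A × B) × G => F p.1.1 p.1.2 p.2) *
        l2norm (fun p : (B × D) × G => K p.1.1 p.1.2 p.2) *
        l2norm (fun p : (A × D) × G => k p.1.1 p.1.2 p.2) := by
  calc _ ≤ ∑' (a) (b) (d), C * (l2norm (F a b) * l2norm (K b d) * l2norm (k a d)) := by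
        refine ENNReal.tsum_le_tsum fun a => ENNReal.tsum_le_tsum fun b =>
          ENNReal.tsum_le_tsum fun d => (h a b d).trans (le_of_eq ?_)
        ring
    _ = C * ∑' (a) (b) (d), l2norm (F a b) * l2norm (K b d) * l2norm (k a d) := by
        simp_rw [ENNReal.tsum_mul_left]
    _ ≤ _ := by
        rw [mul_assoc, mul_assoc, ← mul_assoc (l2norm _), l2norm_prod, l2norm_prod (α := B × D),
          l2norm_prod (α := A × D)]
        gcongr
        exact tsum_mul_mul_le (fun a b => l2norm (F a b)) (fun b d => l2norm (K b d))
          (fun a d => l2norm (k a d))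

end Analysis

/-! ### Word lengths and lengths of sequences -/

section WordLength

variable {G : Type u} [Group G] {S : Set G}

theorem wordLength_prod_le {l : List G} (hl : ∀ x ∈ l, x ∈ S ∨ x⁻¹ ∈ S) :
    wordLength S l.prod ≤ l.length := Nat.sInf_le ⟨l, rfl, hl, rfl⟩

theorem exists_list_wordLength (hS : Subgroup.closure S = ⊤) (g : G) :
    ∃ l : List G, l.length = wordLength S g ∧ (∀ x ∈ l, x ∈ S ∨ x⁻¹ ∈ S) ∧ l.prod = g := by
  have hg : g ∈ (Subgroup.closure S).toSubmonoid := by simp [hS]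
  rw [Subgroup.closure_toSubmonoid] at hg
  obtain ⟨l, hl, h⟩ := Submonoid.exists_list_of_mem_closure hg
  exact Nat.sInf_mem
    (s := {n | ∃ l : List G, l.length = n ∧ (∀ x ∈ l, x ∈ S ∨ x⁻¹ ∈ S) ∧ l.prod = g})
    ⟨l.length, l, rfl, hl, h⟩

theorem wordLength_one : wordLength S 1 = 0 :=
  Nat.le_zero.1 (wordLength_prod_le (S := S) (l := []) (by simp))

theorem wordLength_mul_le (hS : Subgroup.closure S = ⊤) (g h : G) :
    wordLength S (g * h) ≤ wordLength S g + wordLength S h := by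
  obtain ⟨l, hl, hl', rfl⟩ := exists_list_wordLength hS g
  obtain ⟨k, hk, hk', rfl⟩ := exists_list_wordLength hS h
  rw [← hl, ← hk, ← List.length_append, ← List.prod_append]
  exact wordLength_prod_le fun x hx => (List.mem_append.1 hx).elim (hl' x) (hk' x)

theorem wordLength_inv_le (hS : Subgroup.closure S = ⊤) (g : G) :
    wordLength S g⁻¹ ≤ wordLength S g := by
  obtain ⟨l, hl, hl', rfl⟩ := exists_list_wordLength hS g
  rw [← hl, List.prod_inv_reverse]
  refine (wordLength_prod_le fun x hx => ?_).trans (by simp)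
  obtain ⟨y, hy, rfl⟩ := List.mem_map.1 (List.mem_reverse.1 hx)
  simpa [or_comm] using hl' y hy

/-- A subadditive length function is dominated by word length. -/
theorem le_mul_wordLength (hS : Subgroup.closure S = ⊤) {L : G → ℕ} {C : ℕ} (h1 : L 1 = 0)
    (hmul : ∀ g h, L (g * h) ≤ L g + L h) (hC : ∀ x ∈ S, L x ≤ C ∧ L x⁻¹ ≤ C) (g : G) :
    L g ≤ C * wordLength S g := by
  obtain ⟨l, hl, hl', rfl⟩ := exists_list_wordLength hS g
  rw [← hl]
  clear hl
  induction l with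
  | nil => simp [h1]
  | cons x l ih =>
    have hx : L x ≤ C := by
      rcases hl' x List.mem_cons_self with h | h
      · exact (hC x h).1
      · simpa using (hC _ h).2
    have := ih fun y hy => hl' y (List.mem_cons_of_mem x hy)
    rw [List.prod_cons, List.length_cons, Nat.mul_succ]
    exact (hmul _ _).trans (by omega)

/-- A subadditive length function is dominated by the word length of a finite generating set. -/
theorem exists_le_mul_wordLength (hfin : S.Finite) (hS : Subgroup.closure S = ⊤) {L : G → ℕ}
    (h1 : L 1 = 0) (hmul : ∀ g h, L (g * h) ≤ L g + L h) :
    ∃ C : ℕ, ∀ g, L g ≤ C * wordLength S g := by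
  obtain ⟨C, hC⟩ := (hfin.image fun x => max (L x) (L x⁻¹)).bddAbove
  refine ⟨C, le_mul_wordLength hS h1 hmul fun x hx => ?_⟩
  exact max_le_iff.1 (hC ⟨x, hx, rfl⟩)

theorem HasRapidDecayWrt.mono {L L' : G → ℝ} (h : HasRapidDecayWrt L) {C : ℝ} (hC : 0 ≤ C)
    (hL : ∀ g, L g ≤ C * L' g) : HasRapidDecayWrt L' := by
  obtain ⟨P, hP⟩ := h
  refine ⟨P.comp (Polynomial.C (C + 1) * Polynomial.X), fun r hr f g hf => ?_⟩
  have := hP ((C + 1) * r) (by positivity) f g fun x hx => by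
    have h1 := mul_le_mul_of_nonneg_left (hf x hx) hC
    have h2 := hL x
    linarith
  simpa using this

theorem HasRapidDecay.hasRapidDecayWrt (h : HasRapidDecay G) (hfin : S.Finite)
    (hS : Subgroup.closure S = ⊤) : HasRapidDecayWrt fun g => (wordLength S g : ℝ) := by
  obtain ⟨S', -, hS', h⟩ := h
  obtain ⟨C, hC⟩ := exists_le_mul_wordLength hfin hS (L := wordLength S') wordLength_one
    (wordLength_mul_le hS')
  exact h.mono (Nat.cast_nonneg C) fun g => by exact_mod_cast hC g

end WordLength

namespace GraphOfGroups

variable {V : Type u₁} {E : Type u₂} {𝒢 : GraphOfGroups.{u₁, u₂, u₃, u₄} V E} {a b c u v w x : V}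
  {S : ∀ v, Set (𝒢.vertexGroup v)}

namespace GSeq

theorem edgeCount_le_length (s : 𝒢.GSeq v w) : s.edgeCount ≤ s.length S := by
  induction s with
  | vert g => exact Nat.zero_le _
  | cons g e s ih => simp only [edgeCount, length]; omega

theorem length_lmul_le (hS : ∀ v, Subgroup.closure (S v) = ⊤) (g : 𝒢.vertexGroup v)
    (s : 𝒢.GSeq v w) : (lmul g s).length S ≤ wordLength (S v) g + s.length S := by
  cases s with
  | vert h => exact wordLength_mul_le (hS v) g h
  | cons h e s =>
    have := wordLength_mul_le (hS v) g h
    simp only [lmul_cons, length]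
    omega

theorem length_concat_le (hS : ∀ v, Subgroup.closure (S v) = ⊤) (s : 𝒢.GSeq u v)
    (t : 𝒢.GSeq v w) : (s.concat t).length S ≤ s.length S + t.length S := by
  induction s with
  | vert h => exact length_lmul_le hS h t
  | cons h e s ih =>
    have := ih t
    simp only [concat, length]
    omega

theorem length_inv_le (hS : ∀ v, Subgroup.closure (S v) = ⊤) (s : 𝒢.GSeq v w) :
    s.inv.length S ≤ s.length S := by
  induction s with
  | vert h => exact wordLength_inv_le (hS _) h
  | cons h e s ih =>
    refine (length_concat_le hS _ _).trans ?_
    have := wordLength_inv_le (hS _) h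
    simp only [length, wordLength_one]
    omega

end GSeq

namespace Path

/-- The length of a morphism of the fundamental groupoid: the least `Γ`-length of a sequence
representing it. -/
noncomputable def len (S : ∀ v, Set (𝒢.vertexGroup v)) (p : 𝒢.Path v w) : ℕ :=
  sInf {n | ∃ s : 𝒢.GSeq v w, mk s = p ∧ s.length S = n}

theorem len_mk_le (s : 𝒢.GSeq v w) : (mk s).len S ≤ s.length S := Nat.sInf_le ⟨s, rfl, rfl⟩

theorem exists_length_eq_len (S : ∀ v, Set (𝒢.vertexGroup v)) (p : 𝒢.Path v w) :
    ∃ s : 𝒢.GSeq v w, mk s = p ∧ s.length S = p.len S := by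
  obtain ⟨s, hs⟩ := mk_surjective p
  exact Nat.sInf_mem (s := {n | ∃ s : 𝒢.GSeq v w, mk s = p ∧ s.length S = n}) ⟨_, s, hs, rfl⟩

theorem len_one (S : ∀ v, Set (𝒢.vertexGroup v)) : (ofVertex (1 : 𝒢.vertexGroup v)).len S = 0 :=
  Nat.le_zero.1 ((len_mk_le (GSeq.vert 1)).trans wordLength_one.le)

theorem len_comp_le (hS : ∀ v, Subgroup.closure (S v) = ⊤) (p : 𝒢.Path u v) (q : 𝒢.Path v w) :
    (p ⬝ q).len S ≤ p.len S + q.len S := by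
  obtain ⟨s, rfl, hs⟩ := exists_length_eq_len S p
  obtain ⟨t, rfl, ht⟩ := exists_length_eq_len S q
  rw [← hs, ← ht]
  exact (len_mk_le (s.concat t)).trans (GSeq.length_concat_le hS s t)

theorem len_inv_le (hS : ∀ v, Subgroup.closure (S v) = ⊤) (p : 𝒢.Path u v) :
    p.inv.len S ≤ p.len S := by
  obtain ⟨s, rfl, hs⟩ := exists_length_eq_len S p
  rw [← hs]
  exact (len_mk_le s.inv).trans (GSeq.length_inv_le hS s)

theorem depth_le_len (p : 𝒢.Path v w) : p.depth ≤ p.len S := by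
  obtain ⟨s, rfl, hs⟩ := exists_length_eq_len S p
  exact (depth_mk_le s).trans (hs ▸ s.edgeCount_le_length)

end Path

/-! ### Coordinates at a vertex of a geodesic -/

/-- Two morphisms from `v₀` to `v` are related if they differ by an element of the group of `v`. -/
def treeSetoid (𝒢 : GraphOfGroups.{u₁, u₂, u₃, u₄} V E) (v₀ v : V) : Setoid (𝒢.Path v₀ v) where
  r p q := (p.inv ⬝ q).depth = 0
  iseqv :=
    { refl := fun p => by rw [Path.inv_comp_self, Path.depth_ofVertex]
      symm := fun {p q} h => by rw [← Path.depth_inv, Path.inv_comp, Path.inv_inv, h]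
      trans := fun {p q r} h h' => by
        rw [← Path.comp_inv_comp q r, ← Path.assoc, Path.depth_comp_of_depth_eq_zero h, h'] }

/-- The vertices of the Bass–Serre tree, seen from the base vertex `v₀`, that lie over `v`: the
cosets of the group of `v` in the set of morphisms from `v₀` to `v`. -/
def TreeVertex (𝒢 : GraphOfGroups.{u₁, u₂, u₃, u₄} V E) (v₀ v : V) : Type (max u₁ u₂ u₃) :=
  Quotient (treeSetoid 𝒢 v₀ v)

namespace TreeVertex

variable {v₀ : V}

/-- The tree vertex determined by a morphism. -/
def mk (p : 𝒢.Path v₀ v) : 𝒢.TreeVertex v₀ v := Quotient.mk (treeSetoid 𝒢 v₀ v) p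

theorem mk_eq_mk {p q : 𝒢.Path v₀ v} : mk p = mk q ↔ (p.inv ⬝ q).depth = 0 :=
  ⟨fun h => Quotient.exact h, fun h => Quotient.sound h⟩

theorem exists_rep (S : ∀ v, Set (𝒢.vertexGroup v)) (c : 𝒢.TreeVertex v₀ v) :
    ∃ p, mk p = c ∧ ∀ q, mk q = c → p.len S ≤ q.len S := by
  obtain ⟨p, hp, h⟩ := (measure fun q : 𝒢.Path v₀ v => q.len S).wf.has_min {q | mk q = c}
    (Quotient.exists_rep c)
  exact ⟨p, hp, fun q hq => not_lt.1 (h q hq)⟩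

/-- A morphism of least length among those that determine the tree vertex `c`. -/
noncomputable def rep (S : ∀ v, Set (𝒢.vertexGroup v)) (c : 𝒢.TreeVertex v₀ v) : 𝒢.Path v₀ v :=
  (exists_rep S c).choose

theorem mk_rep (c : 𝒢.TreeVertex v₀ v) : mk (rep S c) = c := (exists_rep S c).choose_spec.1

theorem len_rep_mk_le (p : 𝒢.Path v₀ v) : (rep S (mk p)).len S ≤ p.len S :=
  (exists_rep S (mk p)).choose_spec.2 p rfl

theorem exists_eq_rep_comp (S : ∀ v, Set (𝒢.vertexGroup v)) (p : 𝒢.Path v₀ v) :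
    ∃ g, p = rep S (mk p) ⬝ Path.ofVertex g := by
  obtain ⟨g, hg⟩ := Path.exists_ofVertex (mk_eq_mk.1 (mk_rep (S := S) (mk p)))
  exact ⟨g, by rw [← hg, Path.comp_inv_comp]⟩

/-- The loop at `v₀` that runs along `c`, through the element `g` of the group of `v`, and back
along `d`. -/
noncomputable def loop (S : ∀ v, Set (𝒢.vertexGroup v)) (c : 𝒢.TreeVertex v₀ v)
    (g : 𝒢.vertexGroup v) (d : 𝒢.TreeVertex v₀ v) : 𝒢.Path v₀ v₀ :=
  rep S c ⬝ Path.ofVertex g ⬝ (rep S d).inv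

/-- The tree vertex `c` lies on the geodesic from the base vertex to its image under
`loop S c g d`, at distance `n` from the base vertex. -/
def OnGeodesic (S : ∀ v, Set (𝒢.vertexGroup v)) (n : ℕ) (c : 𝒢.TreeVertex v₀ v)
    (g : 𝒢.vertexGroup v) (d : 𝒢.TreeVertex v₀ v) : Prop :=
  (rep S c).depth = n ∧ (loop S c g d).depth = n + (rep S d).depth

theorem loop_comp_loop (c d k : 𝒢.TreeVertex v₀ v) (g h : 𝒢.vertexGroup v) :
    loop S c g d ⬝ loop S d h k = loop S c (g * h) k := by
  simp only [loop, Path.assoc, Path.ofVertex_mul, Path.inv_comp_comp]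

theorem loop_inv (c d : 𝒢.TreeVertex v₀ v) (g : 𝒢.vertexGroup v) :
    (loop S c g d).inv = loop S d g⁻¹ c := by
  simp only [loop, Path.inv_comp, Path.inv_inv, Path.ofVertex_inv, Path.assoc]

theorem loop_injective (c d : 𝒢.TreeVertex v₀ v) : Function.Injective fun g => loop S c g d := by
  intro g h hgh
  have key (g : 𝒢.vertexGroup v) :
      Path.ofVertex g = (rep S c).inv ⬝ loop S c g d ⬝ rep S d := by
    simp only [loop, Path.assoc, Path.inv_comp_self, Path.comp_one, Path.inv_comp_comp]
  refine Path.ofVertex_injective ?_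
  rw [key, key]
  exact congrArg (fun p => (rep S c).inv ⬝ p ⬝ rep S d) hgh

/-- On geodesics through a vertex at distance `n`, the coordinates of a loop are unique. -/
theorem OnGeodesic.eq_of_loop_eq {n : ℕ} {c d c' d' : 𝒢.TreeVertex v₀ v}
    {g g' : 𝒢.vertexGroup v} (h : OnGeodesic S n c g d) (h' : OnGeodesic S n c' g' d')
    (hl : loop S c g d = loop S c' g' d') : c = c' ∧ d = d' ∧ g = g' := by
  have hy (g : 𝒢.vertexGroup v) (d : 𝒢.TreeVertex v₀ v) :
      (Path.ofVertex g ⬝ (rep S d).inv).depth = (rep S d).depth := by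
    rw [Path.depth_comp_of_depth_eq_zero (Path.depth_ofVertex g), Path.depth_inv]
  obtain rfl : c = c' := by
    rw [← mk_rep (S := S) c, ← mk_rep (S := S) c', mk_eq_mk]
    refine Path.depth_inv_comp_eq_zero_of_geodesic n hl ?_ ?_ h.1 h'.1
    · rw [hy, h.1]; exact h.2
    · rw [hy, h'.1, ← h'.2, ← hl]; rfl
  have h1 : Path.ofVertex g ⬝ (rep S d).inv = Path.ofVertex g' ⬝ (rep S d').inv := by
    rw [← Path.inv_comp_comp (rep S c) (Path.ofVertex g ⬝ (rep S d).inv)]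
    exact (congrArg ((rep S c).inv ⬝ ·) hl).trans (Path.inv_comp_comp _ _)
  obtain rfl : d = d' := by
    rw [← mk_rep (S := S) d, ← mk_rep (S := S) d', mk_eq_mk]
    have h2 : (rep S d).inv ⬝ rep S d' = Path.ofVertex (g⁻¹ * g') := by
      rw [← Path.inv_comp_comp (Path.ofVertex g) (rep S d).inv, h1, Path.assoc, Path.assoc,
        Path.inv_comp_self, Path.comp_one]
      rfl
    rw [h2, Path.depth_ofVertex]
  exact ⟨rfl, rfl, loop_injective c d hl⟩

/-- The coordinates of two loops at the median of the corresponding triangle. -/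
theorem exists_loop_eq (S : ∀ v, Set (𝒢.vertexGroup v)) (p q : 𝒢.Path v₀ v₀) :
    ∃ (v : V) (c d k : 𝒢.TreeVertex v₀ v) (g h : 𝒢.vertexGroup v) (m n : ℕ),
      p = loop S c g d ∧ q = loop S d h k ∧ OnGeodesic S m c g d ∧ OnGeodesic S n d h k ∧
      OnGeodesic S m c (g * h) k := by
  obtain ⟨v, x, y, z, rfl, rfl, h1, h2, h3⟩ := Path.exists_median _ p q rfl
  obtain ⟨y, rfl⟩ : ∃ y', y = y'.inv := ⟨y.inv, (Path.inv_inv y).symm⟩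
  obtain ⟨z, rfl⟩ : ∃ z', z = z'.inv := ⟨z.inv, (Path.inv_inv z).symm⟩
  obtain ⟨g, hg⟩ := exists_eq_rep_comp S x
  obtain ⟨h, hh⟩ := exists_eq_rep_comp S y
  obtain ⟨k, hk⟩ := exists_eq_rep_comp S z
  have hdep {p : 𝒢.Path v₀ v} {g : 𝒢.vertexGroup v} {c : 𝒢.TreeVertex v₀ v}
      (h : p = rep S c ⬝ Path.ofVertex g) : p.depth = (rep S c).depth := by
    rw [h, Path.depth_comp_of_depth_eq_zero_right _ (Path.depth_ofVertex g)]
  have hloop {p q : 𝒢.Path v₀ v} {g g' : 𝒢.vertexGroup v} {c d : 𝒢.TreeVertex v₀ v}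
      (h : p = rep S c ⬝ Path.ofVertex g) (h' : q = rep S d ⬝ Path.ofVertex g') :
      p ⬝ q.inv = loop S c (g * g'⁻¹) d := by
    rw [h, h', loop, Path.inv_comp, Path.ofVertex_mul, Path.ofVertex_inv]
    simp only [Path.assoc]
  rw [Path.assoc, Path.inv_inv, ← Path.assoc y.inv] at h3
  rw [Path.inv_comp_self, Path.one_comp] at h3
  rw [Path.inv_inv] at h2
  simp only [Path.depth_inv] at h1 h2 h3
  have e3 : g * h⁻¹ * (h * k⁻¹) = g * k⁻¹ := by group
  refine ⟨v, mk x, mk y, mk z, g * h⁻¹, h * k⁻¹, x.depth, y.depth, hloop hg hh, ?_,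
    ⟨(hdep hg).symm, ?_⟩, ⟨(hdep hh).symm, ?_⟩, ⟨(hdep hg).symm, ?_⟩⟩
  · rw [Path.inv_inv]; exact hloop hh hk
  · rw [← hloop hg hh, ← hdep hh, h1]
  · rw [← hloop hh hk, ← hdep hk, h2]
  · rw [e3, ← hloop hg hk, ← hdep hk, h3]

theorem OnGeodesic.len_rep_le {n : ℕ} {c d : 𝒢.TreeVertex v₀ v} {g : 𝒢.vertexGroup v}
    (h : OnGeodesic S n c g d) : (rep S c).len S ≤ (loop S c g d).len S := by
  obtain ⟨s, hs, hs'⟩ := Path.exists_length_eq_len S (loop S c g d)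
  obtain ⟨b, t, ht, hd⟩ := Path.exists_length_le S s (rep S c)
    (Path.ofVertex g ⬝ (rep S d).inv) hs (by
      rw [Path.depth_comp_of_depth_eq_zero (Path.depth_ofVertex g), Path.depth_inv, h.1]
      exact h.2)
  obtain rfl := Path.eq_of_depth_eq_zero hd
  have h1 : mk (Path.mk t) = c := by rw [← mk_rep (S := S) c]; exact mk_eq_mk.2 hd
  have h2 := len_rep_mk_le (S := S) (Path.mk t)
  rw [h1] at h2
  exact h2.trans ((Path.len_mk_le t).trans (ht.trans hs'.le))

/-- The middle coordinate of a loop of length at most `r` is represented by a sequence of length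
at most `3 * r`. -/
theorem OnGeodesic.exists_rel {n : ℕ} {c d : 𝒢.TreeVertex v₀ v} {g : 𝒢.vertexGroup v}
    (hS : ∀ v, Subgroup.closure (S v) = ⊤) (h : OnGeodesic S n c g d) {r : ℕ}
    (hr : (loop S c g d).len S ≤ r) :
    ∃ s : 𝒢.GSeq v v, GSeq.Rel s (GSeq.vert g) ∧ s.length S ≤ 3 * r := by
  have h' : OnGeodesic S (rep S d).depth d g⁻¹ c :=
    ⟨rfl, by rw [← loop_inv, Path.depth_inv, h.2, h.1, add_comm]⟩
  have h1 := h.len_rep_le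
  have h2 := h'.len_rep_le
  rw [← loop_inv] at h2
  have h3 := Path.len_inv_le hS (loop S c g d)
  have h4 : Path.ofVertex g = (rep S c).inv ⬝ loop S c g d ⬝ rep S d := by
    simp only [loop, Path.assoc, Path.inv_comp_self, Path.comp_one, Path.inv_comp_comp]
  have h5 := Path.len_comp_le hS (rep S c).inv (loop S c g d ⬝ rep S d)
  have h6 := Path.len_comp_le hS (loop S c g d) (rep S d)
  have h7 := Path.len_inv_le hS (rep S c)
  rw [← h4] at h5
  obtain ⟨s, hs, hs'⟩ := Path.exists_length_eq_len S (Path.ofVertex g)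
  exact ⟨s, Path.mk_eq_mk.1 hs, by omega⟩

end TreeVertex

end GraphOfGroups

/-! ### Finite generation of the fundamental group -/

namespace GraphOfGroups

variable {V : Type u₁} {E : Type u₂} {𝒢 : GraphOfGroups.{u₁, u₂, u₃, u₄} V E} {v w v₀ : V}
  {S : ∀ v, Set (𝒢.vertexGroup v)}

instance [Finite E] : Finite (𝒢.OEdge v w) := by
  let f : E ⊕ E → Σ p : V × V, 𝒢.OEdge p.1 p.2 :=
    Sum.elim (fun e => ⟨(_, _), OEdge.fwd e⟩) fun e => ⟨(_, _), OEdge.bwd e⟩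
  have hf : Function.Surjective f := by
    rintro ⟨⟨v, w⟩, e⟩
    cases e with
    | fwd e => exact ⟨Sum.inl e, rfl⟩
    | bwd e => exact ⟨Sum.inr e, rfl⟩
  have := Finite.of_surjective f hf
  exact Finite.of_injective
    (fun e : 𝒢.OEdge v w => (⟨(v, w), e⟩ : Σ p : V × V, 𝒢.OEdge p.1 p.2))
    fun _ _ h => eq_of_heq (Sigma.mk.inj h).2

/-- A loop at `v₀` in the fundamental groupoid, as an element of the fundamental group. -/
def FundamentalGroup.ofPath (p : 𝒢.Path v₀ v₀) : 𝒢.FundamentalGroup v₀ := p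

theorem FundamentalGroup.ofPath_mul (p q : 𝒢.Path v₀ v₀) :
    ofPath p * ofPath q = ofPath (p ⬝ q) := rfl

/-- The homomorphism from the group of `v` to the fundamental group that is given by a morphism
from the base vertex to `v`. -/
def vertexHom (p : 𝒢.Path v₀ v) : 𝒢.vertexGroup v →* 𝒢.FundamentalGroup v₀ :=
  MonoidHom.mk' (fun g => .ofPath (p ⬝ Path.ofVertex g ⬝ p.inv)) fun g h => by
    rw [FundamentalGroup.ofPath_mul, Path.ofVertex_mul]
    simp only [Path.assoc, Path.inv_comp_comp]

/-- The fundamental group is generated by conjugates of generators of the vertex groups and by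
the edges, closed up to loops along chosen morphisms from the base vertex. -/
theorem exists_finite_generating [Finite V] [Finite E]
    (hS : ∀ v, (S v).Finite ∧ Subgroup.closure (S v) = ⊤) (v₀ : V) :
    ∃ T : Set (𝒢.FundamentalGroup v₀), T.Finite ∧ Subgroup.closure T = ⊤ := by
  let R := {v : V // Nonempty (𝒢.Path v₀ v)}
  let p (v : R) : 𝒢.Path v₀ v := v.2.some
  let edgeLoop (v w : R) (e : 𝒢.OEdge v w) : 𝒢.FundamentalGroup v₀ :=
    .ofPath (p v ⬝ Path.ofEdge e ⬝ (p w).inv)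
  let T : Set (𝒢.FundamentalGroup v₀) :=
    (⋃ v : R, vertexHom (p v) '' S v) ∪ ⋃ (v : R) (w : R), Set.range (edgeLoop v w)
  have hvert (v : R) (g : 𝒢.vertexGroup v) : vertexHom (p v) g ∈ Subgroup.closure T := by
    have h1 : vertexHom (p v) g ∈ (Subgroup.closure (S v)).map (vertexHom (p v)) :=
      ⟨g, by simp [(hS v).2], rfl⟩
    rw [MonoidHom.map_closure] at h1
    refine Subgroup.closure_mono ?_ h1
    exact Set.subset_union_of_subset_left
      (Set.subset_iUnion (fun v : R => vertexHom (p v) '' S v) v) _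
  have hedge (v w : R) (e : 𝒢.OEdge v w) : edgeLoop v w e ∈ Subgroup.closure T :=
    Subgroup.subset_closure (Or.inr (Set.mem_iUnion₂.2 ⟨v, w, e, rfl⟩))
  have hseq {v w : V} (s : 𝒢.GSeq v w) : ∀ (hv : Nonempty (𝒢.Path v₀ v))
      (hw : Nonempty (𝒢.Path v₀ w)),
      FundamentalGroup.ofPath (p ⟨v, hv⟩ ⬝ Path.mk s ⬝ (p ⟨w, hw⟩).inv) ∈ Subgroup.closure T := by
    induction s with
    | vert g => intro hv _; exact hvert ⟨_, hv⟩ g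
    | @cons v u w g e s ih =>
      intro hv hw
      have hu : Nonempty (𝒢.Path v₀ u) := ⟨hv.some ⬝ Path.ofEdge e⟩
      have := mul_mem (mul_mem (hvert ⟨v, hv⟩ g) (hedge ⟨v, hv⟩ ⟨u, hu⟩ e)) (ih hu hw)
      convert this using 1
      simp only [vertexHom, MonoidHom.mk'_apply, edgeLoop, FundamentalGroup.ofPath_mul,
        Path.mk_cons, Path.assoc, Path.inv_comp_comp]
  refine ⟨T, ?_, ?_⟩
  · refine Set.Finite.union (Set.finite_iUnion fun v => (hS v).1.image _)
      (Set.finite_iUnion fun v => Set.finite_iUnion fun w => Set.finite_range _)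
  · refine (Subgroup.eq_top_iff' _).2 fun x => ?_
    obtain ⟨x, rfl⟩ : ∃ y, FundamentalGroup.ofPath y = x := ⟨x, rfl⟩
    have h0 : Nonempty (𝒢.Path v₀ v₀) := ⟨Path.ofVertex 1⟩
    -- every element is conjugate, by the chosen loop at `v₀`, to an element of the closure
    obtain ⟨s, hs⟩ := Path.mk_surjective
      ((p ⟨v₀, h0⟩).inv ⬝ x ⬝ p ⟨v₀, h0⟩)
    have := hseq s h0 h0
    simp only [hs, Path.assoc, Path.comp_inv_comp, Path.comp_inv_self, Path.comp_one] at this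
    exact this

/-! ### The estimate for the fundamental group -/

namespace TreeVertex

open Classical in
/-- The function `f` on the fundamental group in the coordinates `c, g, d` of loops on whose
geodesic the tree vertex `c` lies at distance `n` from the base vertex. -/
noncomputable def coords {M : Type*} [Zero M] (S : ∀ v, Set (𝒢.vertexGroup v))
    (f : 𝒢.Path v₀ v₀ → M) (n : ℕ) (c d : 𝒢.TreeVertex v₀ v) (g : 𝒢.vertexGroup v) : M :=
  if OnGeodesic S n c g d then f (loop S c g d) else 0

theorem OnGeodesic.coords_eq {M : Type*} [Zero M] {n : ℕ} {c d : 𝒢.TreeVertex v₀ v}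
    {g : 𝒢.vertexGroup v} (h : OnGeodesic S n c g d) (f : 𝒢.Path v₀ v₀ → M) :
    coords S f n c d g = f (loop S c g d) := if_pos h

theorem coords_ne_zero {M : Type*} [Zero M] {f : 𝒢.Path v₀ v₀ → M} {n : ℕ}
    {c d : 𝒢.TreeVertex v₀ v} {g : 𝒢.vertexGroup v} (h : coords S f n c d g ≠ 0) :
    OnGeodesic S n c g d ∧ f (loop S c g d) ≠ 0 := by
  rw [coords] at h
  split_ifs at h with h'
  · exact ⟨h', h⟩
  · exact absurd rfl h

theorem l2norm_coords_le (S : ∀ v, Set (𝒢.vertexGroup v)) (f : 𝒢.Path v₀ v₀ → ℝ≥0∞) (n : ℕ) :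
    l2norm (fun p : (𝒢.TreeVertex v₀ v × 𝒢.TreeVertex v₀ v) × 𝒢.vertexGroup v =>
      coords S f n p.1.1 p.1.2 p.2) ≤ l2norm f := by
  refine l2norm_le_of_injOn _ _ (fun p => loop S p.1.1 p.2 p.1.2) ?_ fun p => ?_
  · rintro ⟨⟨c, d⟩, g⟩ h ⟨⟨c', d'⟩, g'⟩ h' hl
    obtain ⟨rfl, rfl, rfl⟩ := (coords_ne_zero h).1.eq_of_loop_eq (coords_ne_zero h').1 hl
    rfl
  · rw [coords]
    split_ifs
    · exact le_rfl
    · exact zero_le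

/-- `coords`, for a finitely supported function, as an element of the group algebra of the
vertex group. -/
noncomputable def block (S : ∀ v, Set (𝒢.vertexGroup v))
    (f : MonoidAlgebra ℝ≥0 (𝒢.FundamentalGroup v₀)) (n : ℕ) (c d : 𝒢.TreeVertex v₀ v) :
    MonoidAlgebra ℝ≥0 (𝒢.vertexGroup v) :=
  .ofCoeff <| Finsupp.ofSupportFinite (coords S (fun p => f.coeff p) n c d) <|
    (f.coeff.support.finite_toSet.preimage (loop_injective (S := S) c d).injOn).subset
      fun _ hg => Finsupp.mem_support_iff.2 (coords_ne_zero hg).2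

theorem coeff_block (f : MonoidAlgebra ℝ≥0 (𝒢.FundamentalGroup v₀)) (n : ℕ)
    (c d : 𝒢.TreeVertex v₀ v) (g : 𝒢.vertexGroup v) :
    (block S f n c d).coeff g = coords S (fun p => f.coeff p) n c d g := rfl

theorem coe_coeff_block (f : MonoidAlgebra ℝ≥0 (𝒢.FundamentalGroup v₀)) (n : ℕ)
    (c d : 𝒢.TreeVertex v₀ v) (g : 𝒢.vertexGroup v) :
    ((block S f n c d).coeff g : ℝ≥0∞) = coords S (fun p => (f.coeff p : ℝ≥0∞)) n c d g := by
  rw [coeff_block, coords, coords]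
  split_ifs <;> rfl

end TreeVertex

/-- A sum is at most another one if each of its non-zero terms is at most some term of the other
one, and the term it came from can be read off (by `j`). -/
theorem tsum_le_tsum_of_exists {α ι : Type*} {f : α → ℝ≥0∞} {h : ι → ℝ≥0∞} (j : ι → α)
    (hj : ∀ x, f x ≠ 0 → ∃ i, j i = x ∧ f x ≤ h i) : ∑' x, f x ≤ ∑' i, h i := by
  choose i hi hf using hj
  rw [← tsum_subtype_support f]
  calc ∑' x : Function.support f, f x ≤ ∑' x : Function.support f, h (i x x.2) :=
        ENNReal.tsum_le_tsum fun x => hf x x.2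
    _ ≤ ∑' i, h i := by
        refine ENNReal.tsum_comp_le_tsum_of_injective (f := fun x : Function.support f => i x x.2)
          (fun x y hxy => Subtype.ext ?_) h
        rw [← hi x x.2, ← hi y y.2]
        exact congrArg j hxy

open TreeVertex in
/-- The trilinear Rapid Decay inequality for the fundamental group, given the inequalities for
the vertex groups: the sum over all pairs of loops is split according to the type of the median
vertex and its distances from two of the corners, and each part is a matrix product. -/
theorem tsum_fundamentalGroup_le [Fintype V] (hS : ∀ v, Subgroup.closure (S v) = ⊤) (N : ℕ)
    (C : V → ℝ≥0∞)
    (hC : ∀ (v : V) (f g : MonoidAlgebra ℝ≥0 (𝒢.vertexGroup v)) (k : 𝒢.vertexGroup v → ℝ≥0∞),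
      (∀ x ∈ f.coeff.support,
        ∃ s : 𝒢.GSeq v v, GSeq.Rel s (GSeq.vert x) ∧ s.length S ≤ 3 * N) →
      ∑' a, ∑' b, (f.coeff a * g.coeff b * k (a * b) : ℝ≥0∞) ≤
        C v * l2norm (fun a => (f.coeff a : ℝ≥0∞)) *
          l2norm (fun a => (g.coeff a : ℝ≥0∞)) * l2norm k)
    (f g : MonoidAlgebra ℝ≥0 (𝒢.FundamentalGroup v₀))
    (hf : ∀ x ∈ f.coeff.support, Path.len S x ≤ N) (k : 𝒢.FundamentalGroup v₀ → ℝ≥0∞) :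
    ∑' a, ∑' b, (f.coeff a * g.coeff b * k (a * b) : ℝ≥0∞) ≤
      ((N + 1) ^ 2 * ∑ v, C v) * l2norm (fun a => (f.coeff a : ℝ≥0∞)) *
        l2norm (fun a => (g.coeff a : ℝ≥0∞)) * l2norm k := by
  let f' : 𝒢.Path v₀ v₀ → ℝ≥0∞ := fun p => f.coeff p
  let g' : 𝒢.Path v₀ v₀ → ℝ≥0∞ := fun p => g.coeff p
  let k' : 𝒢.Path v₀ v₀ → ℝ≥0∞ := fun p => k p
  let I (v : V) := (Fin (N + 1) × Fin (N + 1)) × (𝒢.TreeVertex v₀ v × 𝒢.TreeVertex v₀ v ×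
    𝒢.TreeVertex v₀ v × 𝒢.vertexGroup v × 𝒢.vertexGroup v)
  let h : (Σ v, I v) → ℝ≥0∞ := fun ⟨_, (m, n), c, d, e, x, y⟩ =>
    coords S f' m c d x * coords S g' n d e y * coords S k' m c e (x * y)
  let j : (Σ v, I v) → 𝒢.FundamentalGroup v₀ × 𝒢.FundamentalGroup v₀ :=
    fun ⟨_, _, c, d, e, x, y⟩ => (loop S c x d, loop S d y e)
  have h1 : ∑' a, ∑' b, (f.coeff a * g.coeff b * k (a * b) : ℝ≥0∞) ≤ ∑' i, h i := by
    rw [← ENNReal.tsum_prod]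
    refine tsum_le_tsum_of_exists j ?_
    rintro ⟨a, b⟩ hab
    obtain ⟨v, c, d, e, x, y, m, n, rfl, rfl, hm, hn, hmn⟩ := exists_loop_eq S a b
    have ha : f.coeff (loop S c x d) ≠ 0 := by
      rintro h0
      simp [h0] at hab
    have hlen := hf _ (Finsupp.mem_support_iff.2 ha)
    -- the first loop has at most `N` edges, and `m` and `n` are the distances of the median
    -- from the two ends of its geodesic
    have hc := (hm.len_rep_le).trans hlen
    have hm' := hm
    obtain ⟨hm1, hm2⟩ := hm'
    have hd1 := (Path.depth_le_len (S := S) (loop S c x d)).trans hlen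
    have hm0 : m < N + 1 := by omega
    have hn0 : n < N + 1 := by have := hn.1; omega
    refine ⟨⟨v, (⟨m, hm0⟩, ⟨n, hn0⟩), c, d, e, x, y⟩, rfl, le_of_eq ?_⟩
    change _ = coords S f' m c d x * coords S g' n d e y * coords S k' m c e (x * y)
    rw [hm.coords_eq, hn.coords_eq, hmn.coords_eq, ← loop_comp_loop c d e]
    rfl
  have h2 (v : V) (m n : ℕ) : ∑' (c : 𝒢.TreeVertex v₀ v) (d : 𝒢.TreeVertex v₀ v)
      (e : 𝒢.TreeVertex v₀ v) (x : 𝒢.vertexGroup v) (y : 𝒢.vertexGroup v),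
      coords S f' m c d x * coords S g' n d e y * coords S k' m c e (x * y) ≤
      C v * l2norm f' * l2norm g' * l2norm k' := by
    refine (tsum_matrix_le (C := C v) _ _ _ fun c d e => ?_).trans ?_
    · have := hC v (block S f m c d) (block S g n d e) (coords S k' m c e) ?_
      · simpa only [coe_coeff_block] using this
      · intro x hx
        obtain ⟨hx1, hx2⟩ := coords_ne_zero (Finsupp.mem_support_iff.1 hx)
        exact hx1.exists_rel hS (hf _ (Finsupp.mem_support_iff.2 hx2))
    · gcongr <;> exact l2norm_coords_le S _ _
  refine h1.trans ?_
  rw [ENNReal.tsum_sigma', tsum_fintype, Finset.mul_sum, Finset.sum_mul, Finset.sum_mul,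
    Finset.sum_mul]
  refine Finset.sum_le_sum fun v _ => ?_
  have h3 : ∑' i : I v, h ⟨v, i⟩ = ∑' (m : Fin (N + 1) × Fin (N + 1))
      (c : 𝒢.TreeVertex v₀ v) (d : 𝒢.TreeVertex v₀ v)
      (e : 𝒢.TreeVertex v₀ v) (x : 𝒢.vertexGroup v) (y : 𝒢.vertexGroup v),
      coords S f' m.1 c d x * coords S g' m.2 d e y * coords S k' m.1 c e (x * y) := by
    rw [ENNReal.tsum_prod']
    refine tsum_congr fun m => ?_
    simp only [ENNReal.tsum_prod']
    rfl
  rw [h3, tsum_fintype]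
  refine (Finset.sum_le_card_nsmul _ _ _ fun m _ => h2 v m.1 m.2).trans (le_of_eq ?_)
  simp only [Finset.card_univ, Fintype.card_prod, Fintype.card_fin, nsmul_eq_mul]
  push_cast
  ring_nf
  rfl

end GraphOfGroups

/-! ### Rapid Decay of the fundamental group -/

/-- A real polynomial is bounded on `[0, ∞)` by a monotone one with values at least `1`;
monotonicity is built into the bound by evaluating the two polynomials at `x ≤ y`. -/
theorem Polynomial.exists_bound (P : Polynomial ℝ) :
    ∃ Q : Polynomial ℝ, ∀ x y : ℝ, 0 ≤ x → x ≤ y → P.eval x ≤ Q.eval y ∧ 1 ≤ Q.eval y := by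
  refine ⟨1 + ∑ i ∈ Finset.range (P.natDegree + 1),
    Polynomial.C |P.coeff i| * Polynomial.X ^ i, fun x y hx hxy => ?_⟩
  have hy := hx.trans hxy
  simp only [Polynomial.eval_add, Polynomial.eval_one, Polynomial.eval_finsetSum,
    Polynomial.eval_mul, Polynomial.eval_C, Polynomial.eval_pow, Polynomial.eval_X]
  have h1 : P.eval x ≤ ∑ i ∈ Finset.range (P.natDegree + 1), |P.coeff i| * y ^ i := by
    rw [Polynomial.eval_eq_sum_range]
    refine Finset.sum_le_sum fun i _ => ?_
    exact mul_le_mul (le_abs_self _) (pow_le_pow_left₀ hx hxy i) (pow_nonneg hx i) (abs_nonneg _)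
  have h2 : 0 ≤ ∑ i ∈ Finset.range (P.natDegree + 1), |P.coeff i| * y ^ i :=
    Finset.sum_nonneg fun i _ => mul_nonneg (abs_nonneg _) (pow_nonneg hy i)
  constructor <;> linarith

/-- Rapid Decay of the fundamental group with respect to the least `Γ`-length of the sequences
representing an element. -/
theorem GraphOfGroups.hasRapidDecayWrt_len {V : Type u₁} {E : Type u₂} [Finite V]
    {𝒢 : GraphOfGroups.{u₁, u₂, u₃, u₄} V E} {S : ∀ v, Set (𝒢.vertexGroup v)}
    (hS : ∀ v, Subgroup.closure (S v) = ⊤)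
    (hdist : ∃ P : Polynomial ℝ, ∀ (v : V) (g : 𝒢.vertexGroup v) (s : 𝒢.GSeq v v),
      GSeq.Rel s (GSeq.vert g) → (wordLength (S v) g : ℝ) ≤ P.eval (s.length S : ℝ))
    (hRD : ∀ v, HasRapidDecayWrt fun g => (wordLength (S v) g : ℝ)) (v₀ : V) :
    HasRapidDecayWrt fun γ : 𝒢.FundamentalGroup v₀ => (Path.len S γ : ℝ) := by
  have := Fintype.ofFinite V
  obtain ⟨P, hP⟩ := hdist
  obtain ⟨D, hD⟩ := P.exists_bound
  choose Q hQ using hRD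
  choose B hB using fun v => (Q v).exists_bound
  refine ⟨(Polynomial.X + 1) ^ 2 *
    ∑ v, (B v).comp (D.comp (Polynomial.C 3 * Polynomial.X)), fun r hr f g hf => ?_⟩
  -- vertex elements met by loops of length at most `r` have word length at most `R`
  set R := D.eval (3 * r) with hR
  have hR1 : 1 ≤ R := (hD (3 * r) (3 * r) (by positivity) le_rfl).2
  have hB1 (v : V) : 1 ≤ (B v).eval R := (hB v R R (by positivity) le_rfl).2
  have hN : (⌊r⌋₊ : ℝ) ≤ r := Nat.floor_le hr.le
  have hsum : 0 ≤ ∑ v, (B v).eval R := Finset.sum_nonneg fun v _ => zero_le_one.trans (hB1 v)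
  have heval : ((Polynomial.X + 1) ^ 2 * ∑ v, (B v).comp (D.comp
      (Polynomial.C 3 * Polynomial.X)) : Polynomial ℝ).eval r =
      (r + 1) ^ 2 * ∑ v, (B v).eval R := by
    simp [Polynomial.eval_finsetSum, hR]
  rw [heval]
  refine ell2Norm_le_of_tsum_le (by positivity) fun k => ?_
  refine (tsum_fundamentalGroup_le hS ⌊r⌋₊ (fun v => ENNReal.ofReal ((B v).eval R)) ?_ f g
    (fun x hx => Nat.le_floor (hf x hx)) k).trans ?_
  · intro v f g k hf
    refine tsum_le_of_ell2Norm_le ?_ k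
    refine (hQ v R (by positivity) f g fun x hx => ?_).trans ?_
    · obtain ⟨s, hs, hs'⟩ := hf x hx
      have h3 : (s.length S : ℝ) ≤ 3 * ⌊r⌋₊ := by exact_mod_cast hs'
      exact (hP v x s hs).trans (hD _ _ (Nat.cast_nonneg _) (by linarith)).1
    · have := (hB v R R (by positivity) le_rfl).1
      have h1 := ell2Norm_nonneg f
      have h2 := ell2Norm_nonneg g
      gcongr
  · gcongr
    rw [← ENNReal.ofReal_sum_of_nonneg fun v _ => zero_le_one.trans (hB1 v)]
    have : ((⌊r⌋₊ : ℝ≥0∞) + 1) ^ 2 = ENNReal.ofReal (((⌊r⌋₊ : ℝ) + 1) ^ 2) := by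
      rw [ENNReal.ofReal_pow (by positivity), ENNReal.ofReal_add (by positivity) zero_le_one,
        ENNReal.ofReal_natCast, ENNReal.ofReal_one]
    rw [this, ← ENNReal.ofReal_mul (by positivity)]
    gcongr

theorem mainTheorem3 {V : Type u₁} {E : Type u₂} [Finite V] [Finite E]
    (𝒢 : GraphOfGroups.{u₁, u₂, u₃, u₄} V E)
    (hfg : ∀ v, Group.FG (𝒢.vertexGroup v))
    (hdist : 𝒢.HasLoosePolynomialDistortion)
    (hRD : ∀ v, HasRapidDecay (𝒢.vertexGroup v)) (v₀ : V) :
    HasRapidDecay (𝒢.FundamentalGroup v₀) := by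
  obtain ⟨S, hS, hP⟩ := hdist
  obtain ⟨T, hTfin, hT⟩ := GraphOfGroups.exists_finite_generating hS v₀
  refine ⟨T, hTfin, hT, ?_⟩
  obtain ⟨C, hC⟩ := exists_le_mul_wordLength hTfin hT
    (L := fun γ : 𝒢.FundamentalGroup v₀ => GraphOfGroups.Path.len S γ)
    (GraphOfGroups.Path.len_one S)
    (GraphOfGroups.Path.len_comp_le fun v => (hS v).2)
  exact (GraphOfGroups.hasRapidDecayWrt_len (fun v => (hS v).2) hP
    (fun v => (hRD v).hasRapidDecayWrt (hS v).1 (hS v).2) v₀).mono (Nat.cast_nonneg C)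
      fun γ => by exact_mod_cast hC γ
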